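/- Notation. Data $D$ consist of integers $n,N\ge 0$ and, for $1\le i\le N$, a rational $\epsilon_i\in\mathbb Q$, a vector $a_i\in\mathbb Z^n$, an integer $s_i\ge 0$ and nonzero vectors $b_{i1},\dots,b_{is_i}\in\mathbb Z^n\setminus\{0\}$. They describe the rational function $$g_D(z)=\sum_{i=1}^N \epsilon_i\,\frac{z^{a_i}}{\prod_{j=1}^{s_i}(1-z^{b_{ij}})}\in\mathbb Q(z_1,\dots,z_n).$$ Put $s=\max_i s_i$ ($s=0$ if $N=0$). For a bounded $P\subset\mathbb R^n$ let $g_P(z)=\sum_{\alpha\in P\cap\mathbb Z^n}z^\alpha$. The $m$-th Todd polynomial $\mathrm{td}_m(\xi_1,\dots,\xi_r)$ is the coefficient of $x^m$ in the Taylor series at $x=0$ of $\prod_{j=1}^{r} x\xi_j/(1-e^{-x\xi_j})$. For $\lambda\in\mathbb Q^n$ with $\langle\lambda,b_{ij}\rangle\ne0$ for all $i,j$ and $0\le l\le s_i$ put $$w_{i,l}=w_{i,l}(\lambda)=(-1)^{s_i}\,\frac{\mathrm{td}_{s_i-l}(-\langle\lambda,b_{i1}\rangle,\dots,-\langle\lambda,b_{is_i}\rangle)}{l!\,\langle\lambda,b_{i1}\rangle\cdots\langle\lambda,b_{is_i}\rangle}\in\mathbb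 Q .$$ The running time of an algorithm is its number of bit operations (logarithmic-cost random access machine; for polynomial bounds this is the same as the Turing machine model). The encoding size of $D$ is the total binary length of its numbers, plus $n$. Nothing ($n$, $N$, the $s_i$) is fixed. Rational numbers are output as fractions with positive denominator. Theorem. (a) There is an algorithm that, given data $D$ such that $g_D$ is regular at $z=\mathbf 1=(1,\dots,1)$ (that is, its singularity there, if any, is removable), computes $g_D(\mathbf 1)$ in time polynomial in the encoding size of $D$. (b) There is an algorithm that, given data $D$, computes in time polynomial in the encoding size of $D$ a vector $\lambda=(1,\xi,\xi^2,\dots,\xi^{n-1})\in\mathbb Z^n$, with $\xi\in\mathbb Z$, such that $\langle\lambda,b_{ij}\rangle\neq0$ for all $i,j$, and the rational weights $w_{i,l}=w_{i,l}(\lambda)$ for $1\le i\le N$, $0\le l\le s_i$. If $g_D$ is regular at $\mathbf 1$, then $$g_D(\mathbf 1)=\sum_{i=1}^N\epsilon_i\sum_{l=0}^{s_i}w_{i,l}\,\langle\lambda,a_i\rangle^l ;$$ in particular, if $g_D=g_P$ for a polytope $P\subset\mathbb R^n$, then $\#(P\cap\mathbb Z^n)$ is equal to this sum. (c) Let $P\subset\mathbb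 R^n$ be an integral polytope, let $D$ be data as above and $v_1,\dots,v_N\in\mathbb Z^n$, and suppose that for every integer $k>0$ $$g_{kP}(z)=\sum_{i=1}^N\epsilon_i\,\frac{z^{a_i+(k-1)v_i}}{\prod_{j=1}^{s_i}(1-z^{b_{ij}})} .$$ Then for every $\lambda\in\mathbb Q^n$ with $\langle\lambda,b_{ij}\rangle\ne0$ for all $i,j$, the Ehrhart polynomial of $P$, i.e. the polynomial $i(P,k)$ with $i(P,k)=\#(kP\cap\mathbb Z^n)$ for all integers $k>0$, is $$i(P,k)=\sum_{m=0}^{M}\Bigl(\sum_{i=1}^N\epsilon_i\,\langle\lambda,v_i\rangle^m\sum_{l=m}^{s_i}\binom lm\,w_{i,l}\,\langle\lambda,a_i-v_i\rangle^{l-m}\Bigr)k^m,\qquad M=\min\{s,\dim P\},$$ where $w_{i,l}=w_{i,l}(\lambda)$. -/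

import Mathlib

open scoped Pointwise

/-! ### Algorithms: random access machines with logarithmic (bit) cost

A program is a structured program text over finitely many integer arrays (the memory).  Every
elementary operation is charged with the binary length of all numbers involved, addresses
included; multiplication and division are charged with the product of the lengths of the operands.
Polynomial time in this model is polynomial time on a Turing machine. -/

namespace RAM

/-- Binary length of an integer, with one further bit for the sign. -/
def intSize (z : ℤ) : ℕ := z.natAbs.size + 1

/-- The memory: cell `i` of array number `x` contains `σ x i`. -/
abbrev Store := ℕ → ℤ → ℤ

/-- Arithmetic expressions; `read x e` is the content of array `x` at the address given by `e`. -/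
inductive Expr where
  | const (c : ℤ)
  | read (x : ℕ) (e : Expr)
  | add (e₁ e₂ : Expr)
  | sub (e₁ e₂ : Expr)
  | mul (e₁ e₂ : Expr)
  | div (e₁ e₂ : Expr)

/-- Value of an expression (`div` is integer division). -/
def Expr.eval (σ : Store) : Expr → ℤ
  | const c => c
  | read x e => σ x (e.eval σ)
  | add e₁ e₂ => e₁.eval σ + e₂.eval σ
  | sub e₁ e₂ => e₁.eval σ - e₂.eval σ
  | mul e₁ e₂ => e₁.eval σ * e₂.eval σ
  | div e₁ e₂ => e₁.eval σ / e₂.eval σ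

/-- Bit cost of the evaluation of an expression. -/
def Expr.cost (σ : Store) : Expr → ℕ
  | const c => intSize c
  | read x e => e.cost σ + intSize (e.eval σ) + intSize (σ x (e.eval σ))
  | add e₁ e₂ => e₁.cost σ + e₂.cost σ + intSize (e₁.eval σ + e₂.eval σ)
  | sub e₁ e₂ => e₁.cost σ + e₂.cost σ + intSize (e₁.eval σ - e₂.eval σ)
  | mul e₁ e₂ => e₁.cost σ + e₂.cost σ + intSize (e₁.eval σ) * intSize (e₂.eval σ)
  | div e₁ e₂ => e₁.cost σ + e₂.cost σ + intSize (e₁.eval σ) * intSize (e₂.eval σ)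

/-- Programs.  `assign x i e` stores the value of `e` in array `x` at address `i`; the conditional
and the loop test whether the value of an expression is positive. -/
inductive Prog where
  | skip
  | assign (x : ℕ) (i e : Expr)
  | seq (P Q : Prog)
  | ite (e : Expr) (P Q : Prog)
  | loop (e : Expr) (P : Prog)

/-- The store after writing the value `z` into cell `i` of array `x`. -/
def write (σ : Store) (x : ℕ) (i z : ℤ) : Store :=
  Function.update σ x (Function.update (σ x) i z)

/-- `Exec P σ t τ`: started in the store `σ`, the program `P` halts after time `t` in the
store `τ`. -/
inductive Exec : Prog → Store → ℕ → Store → Prop where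
  | skip (σ : Store) : Exec .skip σ 1 σ
  | assign (x : ℕ) (i e : Expr) (σ : Store) :
      Exec (.assign x i e) σ (1 + i.cost σ + e.cost σ) (write σ x (i.eval σ) (e.eval σ))
  | seq {P Q : Prog} {σ τ ρ : Store} {t u : ℕ} :
      Exec P σ t τ → Exec Q τ u ρ → Exec (.seq P Q) σ (t + u) ρ
  | ite_pos {e : Expr} {P Q : Prog} {σ τ : Store} {t : ℕ} :
      0 < e.eval σ → Exec P σ t τ → Exec (.ite e P Q) σ (1 + e.cost σ + t) τ
  | ite_neg {e : Expr} {P Q : Prog} {σ τ : Store} {t : ℕ} :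
      ¬ 0 < e.eval σ → Exec Q σ t τ → Exec (.ite e P Q) σ (1 + e.cost σ + t) τ
  | loop_stop {e : Expr} {P : Prog} {σ : Store} :
      ¬ 0 < e.eval σ → Exec (.loop e P) σ (1 + e.cost σ) σ
  | loop_step {e : Expr} {P : Prog} {σ τ ρ : Store} {t u : ℕ} :
      0 < e.eval σ → Exec P σ t τ → Exec (.loop e P) τ u ρ →
      Exec (.loop e P) σ (1 + e.cost σ + t + u) ρ

/-- Initial store: the input is written in array `0` from address `0` on, all other cells are
`0`. -/
def input (L : List ℤ) : Store := fun x i =>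
  if x = 0 ∧ 0 ≤ i then L.getD i.toNat 0 else 0

/-- The list `L` stands in array `1` from address `0` on. -/
def HasOutput (τ : Store) (L : List ℤ) : Prop :=
  ∀ (k : ℕ) (hk : k < L.length), τ 1 k = L[k]

/-- Started on the input `L`, the program `P` halts within time `T` in a store `τ` whose output
is `L'`. -/
def OutputsWithin (P : Prog) (L : List ℤ) (T : ℕ) (L' : List ℤ) : Prop :=
  ∃ (t : ℕ) (τ : Store), Exec P (input L) t τ ∧ t ≤ T ∧ HasOutput τ L'

end RAM

/-! ### Rational functions in several variables -/

noncomputable section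

/-- The field `ℚ(z₁,…,zₙ)`. -/
abbrev RationalFunction (n : ℕ) : Type := FractionRing (MvPolynomial (Fin n) ℚ)

/-- The Laurent monomial `z^a`. -/
def laurentMonomial {n : ℕ} (a : Fin n → ℤ) : RationalFunction n :=
  ∏ k, (algebraMap (MvPolynomial (Fin n) ℚ) (RationalFunction n) (MvPolynomial.X k)) ^ (a k)

/-- The rational function `g` is regular at `z = (1,…,1)` (that is, the singularity there, if any,
is removable), and its value there is `c`. -/
def HasValueAtOne {n : ℕ} (g : RationalFunction n) (c : ℚ) : Prop :=
  ∃ p q : MvPolynomial (Fin n) ℚ, MvPolynomial.eval 1 q ≠ 0 ∧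
    g = algebraMap _ (RationalFunction n) p / algebraMap _ (RationalFunction n) q ∧
    c = MvPolynomial.eval 1 p / MvPolynomial.eval 1 q

/-- The data `ε_i ∈ ℚ`, `a_i ∈ ℤⁿ`, `b_ij ∈ ℤⁿ \ {0}` (`i < N`, `j < s_i`) of a sum of rational
functions `∑ ε_i z^{a_i} / ∏_j (1 - z^{b_ij})`. -/
structure RationalSum where
  n : ℕ
  N : ℕ
  s : Fin N → ℕ
  ε : Fin N → ℚ
  a : Fin N → Fin n → ℤ
  b : (i : Fin N) → Fin (s i) → Fin n → ℤ
  b_ne_zero : ∀ i j, b i j ≠ 0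

namespace RationalSum

/-- The rational function described by the data. -/
def toRationalFunction (D : RationalSum) : RationalFunction D.n :=
  ∑ i, algebraMap (MvPolynomial (Fin D.n) ℚ) (RationalFunction D.n) (MvPolynomial.C (D.ε i)) *
    (laurentMonomial (D.a i) / ∏ j, (1 - laurentMonomial (D.b i j)))

/-- The data as a list of integers: `n`, `N`, and then for each `i` the numerator and the
denominator of `ε_i`, the number `s_i`, and the coordinates of `a_i` and of all `b_ij`. -/
def encode (D : RationalSum) : List ℤ :=
  [(D.n : ℤ), (D.N : ℤ)] ++
    (List.ofFn fun i : Fin D.N =>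
      [(D.ε i).num, ((D.ε i).den : ℤ), (D.s i : ℤ)] ++ List.ofFn (D.a i) ++
        (List.ofFn fun j => List.ofFn (D.b i j)).flatten).flatten

/-- Encoding size: the total binary length of the data.  The dimension `n` is counted with its
value; this matters only for `N = 0`, since otherwise there are at least `n` numbers in the list. -/
def size (D : RationalSum) : ℕ := D.n + (D.encode.map RAM.intSize).sum

/-- The maximal number of binomials in a denominator. -/
def maxS (D : RationalSum) : ℕ := Finset.univ.sup D.s

/-- The data with each `a_i` replaced by `a_i + (k - 1) v_i`. -/
def dilate (D : RationalSum) (v : Fin D.N → Fin D.n → ℤ) (k : ℕ) : RationalSum :=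
  { D with a := fun i => D.a i + ((k : ℤ) - 1) • v i }

end RationalSum

/-! ### Todd polynomials and the weights -/

/-- The power series of `x / (1 - exp (-x))`, the inverse of
`(1 - exp (-x)) / x = ∑ (-1)^m x^m / (m+1)!`. -/
def toddSeries : PowerSeries ℚ :=
  (PowerSeries.mk fun m => (-1 : ℚ) ^ m / (m + 1).factorial)⁻¹

/-- The defining identity of the series: `h(x) (1 - exp (-x)) = x`. -/
theorem toddSeries_mul_one_sub_exp_neg :
    toddSeries * (1 - PowerSeries.rescale (-1 : ℚ) (PowerSeries.exp ℚ)) = PowerSeries.X := by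
  have h : (1 - PowerSeries.rescale (-1 : ℚ) (PowerSeries.exp ℚ)) =
      (PowerSeries.mk fun m => (-1 : ℚ) ^ m / (m + 1).factorial) * PowerSeries.X := by
    ext m
    cases m with
    | zero => rw [map_sub, PowerSeries.coeff_rescale]; simp
    | succ m =>
      rw [PowerSeries.coeff_succ_mul_X]
      simp [PowerSeries.coeff_rescale, PowerSeries.coeff_exp, PowerSeries.coeff_one, pow_succ]
      ring
  rw [h, ← mul_assoc, toddSeries, PowerSeries.inv_mul_cancel _ (by simp), one_mul]

/-- The value `td_m(ξ₁,…,ξ_s)` of the `m`-th Todd polynomial: the coefficient of `x^m` in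
`∏_j x ξ_j / (1 - exp (-x ξ_j))`. -/
def todd {s : ℕ} (m : ℕ) (ξ : Fin s → ℚ) : ℚ :=
  PowerSeries.coeff m (∏ j, PowerSeries.rescale (ξ j) toddSeries)

/-- The pairing `⟨lam, a⟩`. -/
def pairing {n : ℕ} (lam : Fin n → ℚ) (a : Fin n → ℤ) : ℚ := ∑ k, lam k * (a k : ℚ)

/-- The weight `w_{i,l} = (-1)^{s_i} td_{s_i - l}(-⟨lam, b_i1⟩, …) / (l! ∏_j ⟨lam, b_ij⟩)`,
for `l ≤ s_i`. -/
def RationalSum.weight (D : RationalSum) (lam : Fin D.n → ℚ) (i : Fin D.N) (l : ℕ) : ℚ :=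
  (-1) ^ D.s i * todd (D.s i - l) (fun j => -pairing lam (D.b i j)) /
    (l.factorial * ∏ j, pairing lam (D.b i j))

/-! ### Polytopes and their integer points -/

/-- The integer points of a subset of `ℝⁿ`. -/
def latticePoints {n : ℕ} (P : Set (Fin n → ℝ)) : Set (Fin n → ℤ) :=
  {α | (fun k => (α k : ℝ)) ∈ P}

/-- A polytope is the convex hull of finitely many points. -/
def IsPolytope {n : ℕ} (P : Set (Fin n → ℝ)) : Prop :=
  ∃ V : Finset (Fin n → ℝ), P = convexHull ℝ (V : Set (Fin n → ℝ))

/-- An integral polytope is the convex hull of finitely many integer points. -/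
def IsIntegralPolytope {n : ℕ} (P : Set (Fin n → ℝ)) : Prop :=
  ∃ V : Finset (Fin n → ℤ),
    P = convexHull ℝ ((fun (α : Fin n → ℤ) (k : Fin n) => (α k : ℝ)) '' (V : Set (Fin n → ℤ)))

/-- The multivariate generating function `∑_{α ∈ P ∩ ℤⁿ} z^α` of a bounded set `P` (a finite sum),
as a rational function. -/
def generatingFunction {n : ℕ} (P : Set (Fin n → ℝ)) : RationalFunction n :=
  ∑ᶠ α ∈ latticePoints P, laurentMonomial α

/-- The dimension of (the affine hull of) a nonempty subset of `ℝⁿ`. -/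
def polytopeDim {n : ℕ} (P : Set (Fin n → ℝ)) : ℕ := Module.finrank ℝ (vectorSpan ℝ P)

/-- `E` is the Ehrhart polynomial of `P`: the (unique) polynomial with
`E(k) = #(kP ∩ ℤⁿ)` for all integers `k > 0`. -/
def IsEhrhartPolynomial {n : ℕ} (P : Set (Fin n → ℝ)) (E : Polynomial ℚ) : Prop :=
  ∀ k : ℕ, 0 < k → E.eval (k : ℚ) = ((latticePoints ((k : ℝ) • P)).ncard : ℚ)

end

/-!
The three parts rest on one identity, `RationalSum.eq_sum_of_hasValueAtOne`. Let `lam` be orthogonal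
to none of the `b_ij`. Substituting `z_k = exp (lam_k x)` turns the summand number `i` into
`ε_i exp (⟨lam, a_i⟩ x) / ∏_j (1 - exp (⟨lam, b_ij⟩ x))`, which is `x ^ (-s_i)` times a power series
whose coefficients are given by Todd polynomials. If the sum is regular at `1`, it is a power series
in `x` whose constant term is the value at `1`; comparing constant terms gives the formula. The
substitution need not be injective on polynomials, so it does not extend to all rational functions;
`HasValueAlong` records the fractions to which it does, and `HasValueAlong.unique` makes the value
well defined.

For the Ehrhart polynomial the formula is applied to the generating function of `k P` for every `k`,
which shows that the number of integer points is a polynomial in `k` of degree at most `s`. It grows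
at most like `k ^ dim P` (`ncard_latticePoints_smul_le`: a suitable choice of `dim P` coordinates is
injective on the affine hull of `k P`), so that the coefficients beyond `dim P` vanish.

The algorithm takes `ξ = 1 + ∑ c²`, the sum being over all numbers `c` of the input. This exceeds
the absolute values of all coordinates of the `b_ij`, so that no `b_ij` is orthogonal to
`(1, ξ, ξ², …)`. For a summand with `s` factors let `β_j` be the pairings with the `b_ij` and let
`F = (s + 1)!`. The coefficients up to `x ^ s` of `∏_j h (-F β_j x)`, with `h` the Todd series, are
integers, and are computed by dividing the series `1` successively, in place, by the series with the
coefficients `(F β_j)^k / (k + 1)!`. The integers that occur stay of polynomial length because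
division by a series with constant term `1` and other coefficients at most `A - 1` multiplies a
common bound for the first `m + 1` coefficients by at most `A ^ m` (`abs_sub_sum_le`). The weights
are written as fractions, and the sum of all contributions is accumulated as one fraction, whose
length grows linearly in the number of terms.

Running times are dealt with once and for all by `RAM.WP`: if all loops make at most `L` passes and
all numbers in the memory have length at most `b`, the time is at most `Prog.price L * b ^ 2`, where
`Prog.price` depends only on the text of the program and is a polynomial in `L`. It then suffices to
bound, for every assignment, the length of the value that is stored.
-/

/-! ### A logic of polynomially bounded executions -/

namespace RAM

theorem one_le_intSize (z : ℤ) : 1 ≤ intSize z := by simp [intSize]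

theorem intSize_le_iff {z : ℤ} {m : ℕ} : intSize z ≤ m + 1 ↔ z.natAbs < 2 ^ m := by
  simp [intSize, Nat.size_le]

theorem natAbs_lt_two_pow_intSize (z : ℤ) : z.natAbs < 2 ^ (intSize z - 1) := by
  simpa [intSize] using Nat.lt_size_self z.natAbs

theorem intSize_add_le (x y : ℤ) : intSize (x + y) ≤ intSize x + intSize y := by
  have hx := natAbs_lt_two_pow_intSize x
  have hy := natAbs_lt_two_pow_intSize y
  obtain ⟨p, hp⟩ := Nat.exists_eq_add_of_le' (one_le_intSize x)
  obtain ⟨q, hq⟩ := Nat.exists_eq_add_of_le' (one_le_intSize y)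
  rw [hp] at hx ⊢
  rw [hq] at hy ⊢
  rw [show p + 1 + (q + 1) = (p + q + 1) + 1 by ring, intSize_le_iff]
  have h1 : 2 ^ p ≤ 2 ^ (p + q) := Nat.pow_le_pow_right (by norm_num) (by omega)
  have h2 : 2 ^ q ≤ 2 ^ (p + q) := Nat.pow_le_pow_right (by norm_num) (by omega)
  have := Int.natAbs_add_le x y
  simp only [Nat.add_sub_cancel] at hx hy
  rw [pow_succ]
  omega

theorem intSize_neg (x : ℤ) : intSize (-x) = intSize x := by simp [intSize]

theorem intSize_sub_le (x y : ℤ) : intSize (x - y) ≤ intSize x + intSize y := by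
  simpa [sub_eq_add_neg, intSize_neg] using intSize_add_le x (-y)

theorem intSize_mul_le (x y : ℤ) : intSize (x * y) ≤ intSize x + intSize y := by
  have hx := natAbs_lt_two_pow_intSize x
  have hy := natAbs_lt_two_pow_intSize y
  obtain ⟨p, hp⟩ := Nat.exists_eq_add_of_le' (one_le_intSize x)
  obtain ⟨q, hq⟩ := Nat.exists_eq_add_of_le' (one_le_intSize y)
  rw [hp] at hx ⊢
  rw [hq] at hy ⊢
  refine le_trans (intSize_le_iff.2 (?_ : _ < 2 ^ (p + q))) (by omega)
  rw [Int.natAbs_mul, pow_add]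
  exact Nat.mul_lt_mul'' (by simpa using hx) (by simpa using hy)

theorem intSize_mono {x y : ℤ} (h : x.natAbs ≤ y.natAbs) : intSize x ≤ intSize y :=
  Nat.succ_le_succ (Nat.size_le_size h)

theorem intSize_div_le (x y : ℤ) : intSize (x / y) ≤ intSize x :=
  intSize_mono (Int.natAbs_ediv_le_natAbs x y)

theorem intSize_natCast_le (k : ℕ) : intSize (k : ℤ) ≤ k + 1 :=
  intSize_le_iff.2 (by simpa using Nat.lt_two_pow_self)

theorem intSize_le_of_abs_le {z : ℤ} {e b : ℕ} (h : |z| ≤ 2 ^ e) (hb : e + 2 ≤ b) :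
    intSize z ≤ b := by
  refine le_trans (intSize_le_iff.2 (?_ : _ < 2 ^ (e + 1))) hb
  have : (z.natAbs : ℤ) ≤ 2 ^ e := by rwa [Int.natCast_natAbs]
  have h' : z.natAbs ≤ 2 ^ e := by exact_mod_cast this
  exact h'.trans_lt (Nat.pow_lt_pow_right (by norm_num) (by omega))

theorem abs_le_two_pow_of_intSize_le {z : ℤ} {e : ℕ} (h : intSize z ≤ e + 1) : |z| ≤ 2 ^ e := by
  have h1 : z.natAbs < 2 ^ e := intSize_le_iff.1 h
  rw [← Int.natCast_natAbs]
  exact_mod_cast h1.le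

/-- A factor by which the binary length of the value of an expression can exceed that of the
contents of the memory. -/
def Expr.len : Expr → ℕ
  | .const c => intSize c
  | .read _ _ => 1
  | .add e₁ e₂ => e₁.len + e₂.len
  | .sub e₁ e₂ => e₁.len + e₂.len
  | .mul e₁ e₂ => e₁.len + e₂.len
  | .div e₁ e₂ => e₁.len + e₂.len

/-- The cost of evaluating an expression is at most `price * b ^ 2` if all numbers in the memory
have length at most `b`. -/
def Expr.price : Expr → ℕ
  | .const c => intSize c
  | .read _ e => e.price + e.len + 1
  | .add e₁ e₂ => e₁.price + e₂.price + (e₁.len + e₂.len)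
  | .sub e₁ e₂ => e₁.price + e₂.price + (e₁.len + e₂.len)
  | .mul e₁ e₂ => e₁.price + e₂.price + e₁.len * e₂.len
  | .div e₁ e₂ => e₁.price + e₂.price + e₁.len * e₂.len

/-- All numbers in the memory have binary length at most `b`. -/
def Bounded (b : ℕ) (σ : Store) : Prop := ∀ x i, intSize (σ x i) ≤ b

theorem Bounded.one_le {b : ℕ} {σ : Store} (h : Bounded b σ) : 1 ≤ b :=
  (one_le_intSize _).trans (h 0 0)

theorem Expr.intSize_eval_le {b : ℕ} {σ : Store} (h : Bounded b σ) (e : Expr) :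
    intSize (e.eval σ) ≤ e.len * b := by
  induction e with
  | const c => exact Nat.le_mul_of_pos_right _ h.one_le
  | read x e => simpa [eval, len] using h x _
  | add e₁ e₂ h₁ h₂ =>
    simp only [eval, len, add_mul]; exact (intSize_add_le _ _).trans (add_le_add h₁ h₂)
  | sub e₁ e₂ h₁ h₂ =>
    simp only [eval, len, add_mul]; exact (intSize_sub_le _ _).trans (add_le_add h₁ h₂)
  | mul e₁ e₂ h₁ h₂ =>
    simp only [eval, len, add_mul]; exact (intSize_mul_le _ _).trans (add_le_add h₁ h₂)
  | div e₁ e₂ h₁ h₂ =>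
    simp only [eval, len, add_mul]; exact (intSize_div_le _ _).trans (h₁.trans (Nat.le_add_right _ _))

theorem Expr.cost_le {b : ℕ} {σ : Store} (h : Bounded b σ) (e : Expr) :
    e.cost σ ≤ e.price * b ^ 2 := by
  have hb : b ≤ b ^ 2 := Nat.le_self_pow (by norm_num) b
  have lin : ∀ {z l : ℕ}, z ≤ l * b → z ≤ l * b ^ 2 := fun hz =>
    hz.trans (Nat.mul_le_mul_left _ hb)
  have prod : ∀ e₁ e₂ : Expr, intSize (e₁.eval σ) * intSize (e₂.eval σ) ≤
      e₁.len * e₂.len * b ^ 2 := fun e₁ e₂ =>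
    (Nat.mul_le_mul (e₁.intSize_eval_le h) (e₂.intSize_eval_le h)).trans_eq (by ring)
  induction e with
  | const c => exact Nat.le_mul_of_pos_right _ (pow_pos h.one_le 2)
  | read x e ih =>
    simp only [cost, price, add_mul, one_mul]
    exact add_le_add (add_le_add ih (lin (e.intSize_eval_le h))) ((h _ _).trans hb)
  | add e₁ e₂ h₁ h₂ =>
    have := lin (intSize_eval_le h (.add e₁ e₂))
    simp only [cost, price, add_mul, len, eval] at this ⊢
    omega
  | sub e₁ e₂ h₁ h₂ =>
    have := lin (intSize_eval_le h (.sub e₁ e₂))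
    simp only [cost, price, add_mul, len, eval] at this ⊢
    omega
  | mul e₁ e₂ h₁ h₂ =>
    simp only [cost, price, add_mul]
    exact add_le_add (add_le_add h₁ h₂) (prod e₁ e₂)
  | div e₁ e₂ h₁ h₂ =>
    simp only [cost, price, add_mul]
    exact add_le_add (add_le_add h₁ h₂) (prod e₁ e₂)

/-- The running time of a program is at most `price L * b ^ 2` if every loop in it makes at most
`L` passes and all numbers in the memory have length at most `b` throughout. -/
def Prog.price (L : ℕ) : Prog → ℕ
  | .skip => 1
  | .assign _ i e => 1 + i.price + e.price
  | .seq P Q => P.price L + Q.price L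
  | .ite e P Q => 1 + e.price + (P.price L + Q.price L)
  | .loop e P => (L + 1) * (1 + e.price + P.price L)

theorem Prog.exists_polynomial_price (P : Prog) :
    ∃ p : Polynomial ℕ, ∀ L, P.price L = p.eval L := by
  induction P with
  | skip => exact ⟨1, fun L => by simp [price]⟩
  | assign x i e =>
    exact ⟨Polynomial.C (1 + i.price + e.price), fun L => by rw [Polynomial.eval_C]; rfl⟩
  | seq P Q hP hQ =>
    obtain ⟨p, hp⟩ := hP
    obtain ⟨q, hq⟩ := hQ
    exact ⟨p + q, fun L => by simp [price, hp, hq]⟩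
  | ite e P Q hP hQ =>
    obtain ⟨p, hp⟩ := hP
    obtain ⟨q, hq⟩ := hQ
    exact ⟨Polynomial.C (1 + e.price) + (p + q), fun L => by
      simp only [Polynomial.eval_add, Polynomial.eval_C, price, hp, hq]⟩
  | loop e P hP =>
    obtain ⟨p, hp⟩ := hP
    exact ⟨(Polynomial.X + 1) * (Polynomial.C (1 + e.price) + p), fun L => by
      simp only [Polynomial.eval_add, Polynomial.eval_mul, Polynomial.eval_X, Polynomial.eval_C,
        Polynomial.eval_one, price, hp]⟩

/-- The arrays that a program writes to. -/
def Prog.mods : Prog → List ℕ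
  | .skip => []
  | .assign x _ _ => [x]
  | .seq P Q => P.mods ++ Q.mods
  | .ite _ P Q => P.mods ++ Q.mods
  | .loop _ P => P.mods

theorem write_apply (σ : Store) (x : ℕ) (i z : ℤ) (y : ℕ) (j : ℤ) :
    write σ x i z y j = if y = x ∧ j = i then z else σ y j := by
  unfold write
  by_cases hy : y = x
  · subst hy
    by_cases hj : j = i <;> simp [hj]
  · simp [hy]

theorem write_of_ne (σ : Store) {x y : ℕ} (i z : ℤ) (h : y ≠ x) : write σ x i z y = σ y := by
  simp [write, h]

theorem Exec.frame {P : Prog} {σ τ : Store} {t : ℕ} (h : Exec P σ t τ) :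
    ∀ x ∉ P.mods, τ x = σ x := by
  induction h with
  | skip => exact fun _ _ => rfl
  | assign x i e σ => exact fun y hy => write_of_ne σ _ _ (by simpa [Prog.mods] using hy)
  | seq _ _ h₁ h₂ =>
    intro x hx
    simp only [Prog.mods, List.mem_append, not_or] at hx
    rw [h₂ x hx.2, h₁ x hx.1]
  | ite_pos _ _ ih =>
    intro x hx
    simp only [Prog.mods, List.mem_append, not_or] at hx
    exact ih x hx.1
  | ite_neg _ _ ih =>
    intro x hx
    simp only [Prog.mods, List.mem_append, not_or] at hx
    exact ih x hx.2
  | loop_stop => exact fun _ _ => rfl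
  | loop_step _ _ _ h₁ h₂ => exact fun x hx => (h₂ x hx).trans (h₁ x hx)

theorem Bounded.write {b : ℕ} {σ : Store} (h : Bounded b σ) (x : ℕ) (i : ℤ) {z : ℤ}
    (hz : intSize z ≤ b) : Bounded b (write σ x i z) := by
  intro y j
  rw [write_apply]
  split_ifs
  exacts [hz, h y j]

/-- Started in `σ`, the program `P` halts in a store with the property `Q`.  Moreover, if the
numbers in `σ` have length at most `b`, then so do those in the final store, and the running time
is at most `P.price L * b ^ 2`. -/
def WP (L b : ℕ) (P : Prog) (Q : Store → Prop) (σ : Store) : Prop :=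
  Bounded b σ → ∃ t τ, Exec P σ t τ ∧ t ≤ P.price L * b ^ 2 ∧ Bounded b τ ∧ Q τ

variable {L b : ℕ} {P P' : Prog} {Q Q' : Store → Prop} {σ : Store}

theorem wp_mono (h : WP L b P Q σ) (hQ : ∀ τ, (∀ x ∉ P.mods, τ x = σ x) → Q τ → Q' τ) :
    WP L b P Q' σ := fun hσ => by
  obtain ⟨t, τ, h₁, h₂, h₃, h₄⟩ := h hσ
  exact ⟨t, τ, h₁, h₂, h₃, hQ τ h₁.frame h₄⟩

theorem wp_seq (h : WP L b P (WP L b P' Q) σ) : WP L b (.seq P P') Q σ := fun hσ => by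
  obtain ⟨t, τ, h₁, h₂, h₃, h₄⟩ := h hσ
  obtain ⟨u, ρ, k₁, k₂, k₃, k₄⟩ := h₄ h₃
  exact ⟨t + u, ρ, .seq h₁ k₁, by rw [Prog.price, add_mul]; exact add_le_add h₂ k₂, k₃, k₄⟩

theorem wp_assign {x : ℕ} {i e : Expr} (he : intSize (e.eval σ) ≤ b)
    (hQ : Q (write σ x (i.eval σ) (e.eval σ))) : WP L b (.assign x i e) Q σ := fun hσ => by
  refine ⟨_, _, .assign x i e σ, ?_, hσ.write _ _ he, hQ⟩
  have h1 : 1 ≤ b ^ 2 := Nat.one_le_pow _ _ hσ.one_le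
  have h2 := i.cost_le hσ
  have h3 := e.cost_le hσ
  simp only [Prog.price, add_mul, one_mul]
  omega

/-- The scalar variable number `x`: cell `0` of array `x`. -/
abbrev var (x : ℕ) : Expr := .read x (.const 0)

/-- Assignment to a scalar variable. -/
abbrev setVar (x : ℕ) (e : Expr) : Prog := .assign x (.const 0) e

/-- `for x = 0, …, e - 1 do P`. -/
def forLoop (x : ℕ) (e : Expr) (P : Prog) : Prog :=
  .seq (setVar x (.const 0))
    (.loop (.sub e (var x)) (.seq P (setVar x (.add (var x) (.const 1)))))

theorem mods_forLoop (x : ℕ) (e : Expr) (P : Prog) :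
    (forLoop x e P).mods = x :: (P.mods ++ [x]) := rfl

theorem wp_setVar {x : ℕ} {e : Expr} (he : intSize (e.eval σ) ≤ b)
    (hQ : Q (write σ x 0 (e.eval σ))) : WP L b (setVar x e) Q σ := wp_assign he hQ

/-- The rule for counting loops: `I k` is the invariant at the beginning of pass number `k`. -/
theorem wp_forLoop {x : ℕ} {e : Expr} {n : ℕ} (I : ℕ → Store → Prop)
    (hn : n ≤ L) (hL : L + 1 ≤ b) (hx : x ∉ P.mods)
    (he : ∀ τ, (∀ y, y ≠ x → y ∉ P.mods → τ y = σ y) → e.eval τ = n)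
    (h0 : I 0 (write σ x 0 0))
    (hstep : ∀ k < n, ∀ τ, (∀ y, y ≠ x → y ∉ P.mods → τ y = σ y) → τ x 0 = (k : ℤ) → I k τ →
      WP L b P (fun ρ => I (k + 1) (write ρ x 0 ((k : ℤ) + 1))) τ)
    (hQ : ∀ τ, (∀ y, y ≠ x → y ∉ P.mods → τ y = σ y) → I n τ → Q τ) :
    WP L b (forLoop x e P) Q σ := by
  have hb : ∀ k ≤ n, intSize (k : ℤ) ≤ b := fun k hk => (intSize_natCast_le k).trans (by omega)
  have key : ∀ m k, k + m = n → ∀ τ, (∀ y, y ≠ x → y ∉ P.mods → τ y = σ y) → τ x 0 = (k : ℤ) →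
      I k τ → Bounded b τ → ∃ t ρ,
      Exec (.loop (.sub e (var x)) (.seq P (setVar x (.add (var x) (.const 1))))) τ t ρ ∧
        t ≤ (m + 1) * (1 + (Expr.sub e (var x)).price +
          (Prog.seq P (setVar x (.add (var x) (.const 1)))).price L) * b ^ 2 ∧
        Bounded b ρ ∧ Q ρ := by
    intro m
    induction m with
    | zero =>
      intro k hk τ hf hτx hI hτ
      have hk' : k = n := by omega
      subst hk'
      refine ⟨_, τ, Exec.loop_stop ?_, ?_, hτ, hQ τ hf hI⟩
      · simp [Expr.eval, he τ hf, hτx]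
      · have h1 : 1 ≤ b ^ 2 := Nat.one_le_pow _ _ hτ.one_le
        have h2 := (Expr.sub e (var x)).cost_le hτ
        simp only [zero_add, add_mul, one_mul]
        omega
    | succ m ih =>
      intro k hk τ hf hτx hI hτ
      obtain ⟨t, ρ, e₁, e₂, e₃, e₄⟩ := hstep k (by omega) τ hf hτx hI hτ
      have hρx : ρ x 0 = k := by rw [e₁.frame x hx, hτx]
      have hval : (Expr.add (var x) (.const 1)).eval ρ = ((k + 1 : ℕ) : ℤ) := by
        simp [Expr.eval, hρx]
      have hset := wp_setVar (L := L) (b := b) (x := x) (e := .add (var x) (.const 1)) (σ := ρ)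
        (Q := fun ρ' => ρ' = write ρ x 0 ((k + 1 : ℕ) : ℤ))
        (by rw [hval]; exact hb _ (by omega)) (by rw [hval])
      obtain ⟨u, ρ', k₁, k₂, k₃, k₄⟩ := hset e₃
      subst k₄
      have hf' : ∀ y, y ≠ x → y ∉ P.mods → write ρ x 0 ((k + 1 : ℕ) : ℤ) y = σ y :=
        fun y hy hy' => by rw [write_of_ne _ _ _ hy, e₁.frame y hy', hf y hy hy']
      obtain ⟨w, ρ'', l₁, l₂, l₃, l₄⟩ := ih (k + 1) (by omega) _ hf'
        (by rw [write_apply]; simp) (by exact_mod_cast e₄) k₃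
      refine ⟨_, ρ'', .loop_step ?_ (.seq e₁ k₁) l₁, ?_, l₃, l₄⟩
      · simp only [Expr.eval, he τ hf, hτx]; omega
      · have h1 : 1 ≤ b ^ 2 := Nat.one_le_pow _ _ hτ.one_le
        have h2 := (Expr.sub e (var x)).cost_le hτ
        simp only [Prog.price] at l₂ k₂ ⊢
        rw [show m + 1 + 1 = (m + 1) + 1 from rfl, add_mul (m + 1) 1, one_mul, add_mul]
        simp only [add_mul _ _ (b ^ 2), one_mul] at e₂ k₂ h2 ⊢
        omega
  refine wp_seq (wp_setVar ?_ ?_)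
  · exact hb 0 (Nat.zero_le n)
  · intro hσ
    obtain ⟨t, ρ, h₁, h₂, h₃, h₄⟩ := key n 0 (by omega) _
      (fun y hy _ => write_of_ne _ _ _ hy) (by rw [write_apply]; simp) h0 hσ
    exact ⟨t, ρ, h₁, h₂.trans (Nat.mul_le_mul_right _ (Nat.mul_le_mul_right _ (by omega))), h₃, h₄⟩

end RAM

/-! ### Specialization of rational functions -/

/-- The element `g` of the fraction field of `R` can be specialized along the ring homomorphism `φ`
to a field, with value `c`. -/
def HasValueAlong {R K : Type*} [CommRing R] [IsDomain R] [Field K] (φ : R →+* K)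
    (g : FractionRing R) (c : K) : Prop :=
  ∃ p q : R, φ q ≠ 0 ∧ g = algebraMap R (FractionRing R) p / algebraMap R (FractionRing R) q ∧
    c = φ p / φ q

namespace HasValueAlong

theorem algebraMap_ne_zero {R K : Type*} [CommRing R] [Field K] {φ : R →+* K} {q : R}
    (hq : φ q ≠ 0) : algebraMap R (FractionRing R) q ≠ 0 := by
  rw [Ne, FaithfulSMul.algebraMap_eq_zero_iff]
  rintro rfl
  exact hq (map_zero φ)

variable {R K : Type*} [CommRing R] [IsDomain R] [Field K] {φ : R →+* K}
  {g h : FractionRing R} {c d : K}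

/-- Although `φ` need not be injective, the value does not depend on the representing fraction. -/
theorem unique (hc : HasValueAlong φ g c) (hd : HasValueAlong φ g d) : c = d := by
  obtain ⟨p, q, hq, rfl, rfl⟩ := hc
  obtain ⟨p', q', hq', h, rfl⟩ := hd
  rw [div_eq_div_iff (algebraMap_ne_zero hq) (algebraMap_ne_zero hq'), ← map_mul, ← map_mul] at h
  have h' := FaithfulSMul.algebraMap_injective R (FractionRing R) h
  rw [div_eq_div_iff hq hq', ← map_mul, ← map_mul, h']

theorem of_algebraMap (r : R) : HasValueAlong φ (algebraMap R (FractionRing R) r) (φ r) :=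
  ⟨r, 1, by simp, by simp, by simp⟩

theorem one : HasValueAlong φ 1 1 := by
  simpa using of_algebraMap (φ := φ) (1 : R)

theorem zero : HasValueAlong φ 0 0 := by
  simpa using of_algebraMap (φ := φ) (0 : R)

theorem add (hc : HasValueAlong φ g c) (hd : HasValueAlong φ h d) :
    HasValueAlong φ (g + h) (c + d) := by
  obtain ⟨p, q, hq, rfl, rfl⟩ := hc
  obtain ⟨p', q', hq', rfl, rfl⟩ := hd
  refine ⟨p * q' + q * p', q * q', by simp [hq, hq'], ?_, ?_⟩
  · rw [div_add_div _ _ (algebraMap_ne_zero hq) (algebraMap_ne_zero hq')]; simp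
  · rw [div_add_div _ _ hq hq']; simp

theorem mul (hc : HasValueAlong φ g c) (hd : HasValueAlong φ h d) :
    HasValueAlong φ (g * h) (c * d) := by
  obtain ⟨p, q, hq, rfl, rfl⟩ := hc
  obtain ⟨p', q', hq', rfl, rfl⟩ := hd
  refine ⟨p * p', q * q', by simp [hq, hq'], ?_, ?_⟩
  · simp [div_mul_div_comm]
  · simp [div_mul_div_comm]

theorem inv (hc : HasValueAlong φ g c) (h0 : c ≠ 0) : HasValueAlong φ g⁻¹ c⁻¹ := by
  obtain ⟨p, q, hq, rfl, rfl⟩ := hc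
  exact ⟨q, p, fun hp => h0 (by simp [hp]), by simp, by simp⟩

theorem pow (hc : HasValueAlong φ g c) (k : ℕ) : HasValueAlong φ (g ^ k) (c ^ k) := by
  induction k with
  | zero => simpa using one
  | succ k ih => simpa only [pow_succ] using ih.mul hc

theorem zpow (hc : HasValueAlong φ g c) (h0 : c ≠ 0) (k : ℤ) :
    HasValueAlong φ (g ^ k) (c ^ k) := by
  cases k with
  | ofNat k => simpa using hc.pow k
  | negSucc k => simpa only [zpow_negSucc] using (hc.pow (k + 1)).inv (pow_ne_zero _ h0)

theorem sum {ι : Type*} (s : Finset ι) {g : ι → FractionRing R} {c : ι → K}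
    (h : ∀ i ∈ s, HasValueAlong φ (g i) (c i)) :
    HasValueAlong φ (∑ i ∈ s, g i) (∑ i ∈ s, c i) := by
  classical
  induction s using Finset.induction_on with
  | empty => simpa using zero
  | insert a s ha ih =>
    rw [Finset.sum_insert ha, Finset.sum_insert ha]
    exact (h a (by simp)).add (ih fun i hi => h i (by simp [hi]))

theorem prod {ι : Type*} (s : Finset ι) {g : ι → FractionRing R} {c : ι → K}
    (h : ∀ i ∈ s, HasValueAlong φ (g i) (c i)) :
    HasValueAlong φ (∏ i ∈ s, g i) (∏ i ∈ s, c i) := by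
  classical
  induction s using Finset.induction_on with
  | empty => simpa using one
  | insert a s ha ih =>
    rw [Finset.prod_insert ha, Finset.prod_insert ha]
    exact (h a (by simp)).mul (ih fun i hi => h i (by simp [hi]))

end HasValueAlong

theorem hasValueAtOne_iff {n : ℕ} {g : RationalFunction n} {c : ℚ} :
    HasValueAtOne g c ↔ HasValueAlong (MvPolynomial.eval (1 : Fin n → ℚ)) g c := Iff.rfl

theorem hasValueAtOne_laurentMonomial {n : ℕ} (a : Fin n → ℤ) :
    HasValueAtOne (laurentMonomial a) 1 := by
  rw [hasValueAtOne_iff]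
  have h := HasValueAlong.prod (φ := MvPolynomial.eval (1 : Fin n → ℚ)) Finset.univ
    (fun k _ => (HasValueAlong.of_algebraMap (MvPolynomial.X k)).zpow (by simp) (a k))
  simpa [laurentMonomial] using h

/-! ### The substitution `z_k = exp (lam_k x)` -/

noncomputable section

open PowerSeries

/-- The power series `exp (t x)`. -/
def expSeries (t : ℚ) : PowerSeries ℚ := rescale t (exp ℚ)

theorem expSeries_add (s t : ℚ) : expSeries (s + t) = expSeries s * expSeries t :=
  (exp_mul_exp_eq_exp_add s t).symm

theorem expSeries_zero : expSeries 0 = 1 := by simp [expSeries]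

theorem coeff_expSeries (t : ℚ) (l : ℕ) : coeff l (expSeries t) = t ^ l / l.factorial := by
  simp [expSeries, coeff_rescale, coeff_exp, div_eq_mul_inv]

theorem expSeries_sum {ι : Type*} (s : Finset ι) (t : ι → ℚ) :
    expSeries (∑ i ∈ s, t i) = ∏ i ∈ s, expSeries (t i) := by
  classical
  induction s using Finset.induction_on with
  | empty => simpa using expSeries_zero
  | insert a s ha ih => rw [Finset.sum_insert ha, Finset.prod_insert ha, expSeries_add, ih]

/-- The substitution `z_k = exp (lam_k x)`, with values in power series. -/
def expSubst {n : ℕ} (lam : Fin n → ℚ) : MvPolynomial (Fin n) ℚ →+* PowerSeries ℚ :=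
  MvPolynomial.eval₂Hom PowerSeries.C fun k => expSeries (lam k)

theorem constantCoeff_expSubst {n : ℕ} (lam : Fin n → ℚ) (p : MvPolynomial (Fin n) ℚ) :
    constantCoeff (expSubst lam p) = MvPolynomial.eval 1 p := by
  have : (constantCoeff (R := ℚ)).comp (expSubst lam) = MvPolynomial.eval 1 := by
    refine MvPolynomial.ringHom_ext (fun r => by simp [expSubst]) fun k => ?_
    simp [expSubst, expSeries, ← coeff_zero_eq_constantCoeff, coeff_rescale]
  exact DFunLike.congr_fun this p

/-- The substitution `z_k = exp (lam_k x)`, with values in the fraction field of the ring of power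
series. -/
def expSubstFrac {n : ℕ} (lam : Fin n → ℚ) :
    MvPolynomial (Fin n) ℚ →+* FractionRing (PowerSeries ℚ) :=
  (algebraMap (PowerSeries ℚ) (FractionRing (PowerSeries ℚ))).comp (expSubst lam)

theorem algebraMap_powerSeries_injective :
    Function.Injective (algebraMap (PowerSeries ℚ) (FractionRing (PowerSeries ℚ))) :=
  FaithfulSMul.algebraMap_injective _ _

theorem expSeries_ne_zero (t : ℚ) : expSeries t ≠ 0 := fun h => by
  have := expSeries_add t (-t)
  rw [h, add_neg_cancel, expSeries_zero, zero_mul] at this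
  exact one_ne_zero this

theorem algebraMap_expSeries_zpow (t : ℚ) (k : ℤ) :
    (algebraMap (PowerSeries ℚ) (FractionRing (PowerSeries ℚ)) (expSeries t)) ^ k =
      algebraMap _ _ (expSeries (t * k)) := by
  have nat : ∀ m : ℕ, expSeries t ^ m = expSeries (t * m) := fun m => by
    induction m with
    | zero => simp [expSeries_zero]
    | succ m ih => rw [pow_succ, ih, ← expSeries_add]; congr 1; push_cast; ring
  cases k with
  | ofNat k => simp [← nat]
  | negSucc k =>
    rw [zpow_negSucc, ← map_pow, nat]
    refine inv_eq_of_mul_eq_one_left ?_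
    rw [← map_mul, ← expSeries_add]
    convert map_one (algebraMap (PowerSeries ℚ) (FractionRing (PowerSeries ℚ)))
    rw [← expSeries_zero]
    congr 1
    push_cast [Int.negSucc_eq]
    ring

theorem hasValueAlong_laurentMonomial {n : ℕ} (lam : Fin n → ℚ) (a : Fin n → ℤ) :
    HasValueAlong (expSubstFrac lam) (laurentMonomial a)
      (algebraMap _ _ (expSeries (pairing lam a))) := by
  have h := HasValueAlong.prod (φ := expSubstFrac lam) Finset.univ
    (fun k _ => (HasValueAlong.of_algebraMap (MvPolynomial.X k)).zpow
      (by
        simpa [expSubstFrac, expSubst] using expSeries_ne_zero (lam k)) (a k))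
  rw [pairing, expSeries_sum, map_prod]
  convert h using 2 with k
  · rfl
  rw [expSubstFrac, RingHom.comp_apply, expSubst, MvPolynomial.coe_eval₂Hom, MvPolynomial.eval₂_X,
    algebraMap_expSeries_zpow]

/-- The series of `x / (1 - exp (-x))`, rescaled, is up to a factor the inverse of
`1 - exp (t x)`. -/
theorem rescale_toddSeries_mul (t : ℚ) :
    rescale (-t) toddSeries * (1 - expSeries t) = PowerSeries.C (-t) * X := by
  have h := congrArg (rescale (-t)) toddSeries_mul_one_sub_exp_neg
  rw [map_mul, map_sub, map_one, rescale_rescale, rescale_X] at h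
  simpa [expSeries] using h

theorem one_sub_expSeries_ne_zero {t : ℚ} (ht : t ≠ 0) : 1 - expSeries t ≠ 0 := fun h => by
  have := congrArg (coeff 1) (rescale_toddSeries_mul t)
  rw [h] at this
  simp [ht] at this

/-- The coefficient of `x ^ s` in `exp (α x) ∏_j h (ξ_j x)`, with `h` the Todd series. -/
theorem coeff_expSeries_mul_prod {s : ℕ} (α : ℚ) (ξ : Fin s → ℚ) :
    coeff s (expSeries α * ∏ j, rescale (ξ j) toddSeries) =
      ∑ l ∈ Finset.range (s + 1), α ^ l / l.factorial * todd (s - l) ξ := by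
  rw [coeff_mul, Finset.Nat.sum_antidiagonal_eq_sum_range_succ_mk]
  simp only [coeff_expSeries, todd]

namespace RationalSum

variable (D : RationalSum)

theorem hasValueAlong_toRationalFunction {lam : Fin D.n → ℚ}
    (hlam : ∀ i j, pairing lam (D.b i j) ≠ 0) :
    HasValueAlong (expSubstFrac lam) D.toRationalFunction
      (∑ i, algebraMap _ _ (PowerSeries.C (D.ε i)) *
        (algebraMap _ _ (expSeries (pairing lam (D.a i))) /
          ∏ j, algebraMap _ _ (1 - expSeries (pairing lam (D.b i j))))) := by
  refine HasValueAlong.sum _ fun i _ => .mul ?_ ?_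
  · convert HasValueAlong.of_algebraMap (φ := expSubstFrac lam) (MvPolynomial.C (D.ε i))
    rw [expSubstFrac, RingHom.comp_apply, expSubst, MvPolynomial.coe_eval₂Hom,
      MvPolynomial.eval₂_C]
  · rw [div_eq_mul_inv, div_eq_mul_inv]
    refine (hasValueAlong_laurentMonomial lam _).mul (.inv (.prod _ fun j _ => ?_) ?_)
    · have h := (HasValueAlong.one (φ := expSubstFrac lam)).add
        ((HasValueAlong.of_algebraMap (φ := expSubstFrac lam) (-1)).mul
          (hasValueAlong_laurentMonomial lam (D.b i j)))
      convert h using 1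
      · simp [sub_eq_add_neg]
      · simp [sub_eq_add_neg]
    · refine Finset.prod_ne_zero_iff.2 fun j _ => ?_
      rw [Ne, FaithfulSMul.algebraMap_eq_zero_iff]
      exact one_sub_expSeries_ne_zero (hlam i j)

/-- The value at `1` of a sum of rational functions is the constant term of its Laurent expansion
after the substitution `z_k = exp (lam_k x)`. -/
theorem eq_sum_of_hasValueAtOne {c : ℚ} (hc : HasValueAtOne D.toRationalFunction c)
    {lam : Fin D.n → ℚ} (hlam : ∀ i j, pairing lam (D.b i j) ≠ 0) :
    c = ∑ i, D.ε i * ∑ l ∈ Finset.range (D.s i + 1), D.weight lam i l *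
      pairing lam (D.a i) ^ l := by
  obtain ⟨p, q, hq, hg, rfl⟩ := hc
  have hq0 : constantCoeff (expSubst lam q) ≠ 0 := by rwa [constantCoeff_expSubst]
  have hφq : expSubst lam q ≠ 0 := fun h => hq0 (by rw [h, map_zero])
  have hφq' : expSubstFrac lam q ≠ 0 := by
    rw [expSubstFrac, RingHom.comp_apply, Ne, FaithfulSMul.algebraMap_eq_zero_iff]
    exact hφq
  have huniq := HasValueAlong.unique (φ := expSubstFrac lam) ⟨p, q, hφq', hg, rfl⟩
    (D.hasValueAlong_toRationalFunction hlam)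
  -- clearing denominators in the identity of Laurent series
  set κ := algebraMap (PowerSeries ℚ) (FractionRing (PowerSeries ℚ)) with hκ
  have hκ0 : ∀ {u : PowerSeries ℚ}, u ≠ 0 → κ u ≠ 0 := fun hu h =>
    hu (algebraMap_powerSeries_injective (h.trans (map_zero κ).symm))
  set f : PowerSeries ℚ := expSubst lam p * (expSubst lam q)⁻¹ with hf
  have hfrac : expSubstFrac lam p / expSubstFrac lam q = κ f := by
    rw [div_eq_iff hφq', hf]
    simp only [expSubstFrac, RingHom.comp_apply]
    rw [← map_mul, mul_assoc, PowerSeries.inv_mul_cancel _ hq0, mul_one]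
  have hle : ∀ i, D.s i ≤ D.maxS := fun i => Finset.le_sup (f := D.s) (Finset.mem_univ i)
  have hps : f * X ^ D.maxS = ∑ i, PowerSeries.C (D.ε i * (∏ j, -pairing lam (D.b i j))⁻¹) *
      ((expSeries (pairing lam (D.a i)) *
        ∏ j, rescale (-pairing lam (D.b i j)) toddSeries) * X ^ (D.maxS - D.s i)) := by
    apply algebraMap_powerSeries_injective
    rw [map_mul, ← hfrac, huniq, map_sum, Finset.sum_mul]
    refine Finset.sum_congr rfl fun i _ => ?_
    have hpi : ∏ j, (-pairing lam (D.b i j)) ≠ 0 :=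
      Finset.prod_ne_zero_iff.2 fun j _ => neg_ne_zero.2 (hlam i j)
    have hden : ∏ j, κ (1 - expSeries (pairing lam (D.b i j))) ≠ 0 :=
      Finset.prod_ne_zero_iff.2 fun j _ => hκ0 (one_sub_expSeries_ne_zero (hlam i j))
    have key : (∏ j, κ (rescale (-pairing lam (D.b i j)) toddSeries)) *
        ∏ j, κ (1 - expSeries (pairing lam (D.b i j))) =
        κ (PowerSeries.C (∏ j, -pairing lam (D.b i j))) * κ X ^ D.s i := by
      rw [← Finset.prod_mul_distrib]
      simp only [← map_mul κ, rescale_toddSeries_mul]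
      simp only [map_mul, Finset.prod_mul_distrib, Finset.prod_const, map_prod, Finset.card_univ,
        Fintype.card_fin]
    have hCC : κ (PowerSeries.C (∏ j, -pairing lam (D.b i j))⁻¹) *
        κ (PowerSeries.C (∏ j, -pairing lam (D.b i j))) = 1 := by
      rw [← map_mul, ← map_mul, inv_mul_cancel₀ hpi, map_one, map_one]
    have hpow : κ X ^ D.maxS = κ X ^ D.s i * κ X ^ (D.maxS - D.s i) := by
      rw [← pow_add, Nat.add_sub_cancel' (hle i)]
    rw [map_pow, hpow]
    simp only [map_mul, map_prod, map_pow] at hCC key ⊢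
    rw [mul_div_assoc', div_mul_eq_mul_div, div_eq_iff hden]
    linear_combination
      (-(κ (PowerSeries.C (D.ε i)) *
        κ (PowerSeries.C (∏ j, -pairing lam (D.b i j))⁻¹) *
        κ (expSeries (pairing lam (D.a i))) *
        κ X ^ (D.maxS - D.s i))) * key -
      (κ (PowerSeries.C (D.ε i)) *
        κ (expSeries (pairing lam (D.a i))) *
        κ X ^ D.s i * κ X ^ (D.maxS - D.s i)) * hCC
  have hcoeff := congrArg (coeff D.maxS) hps
  -- the constant term of the Laurent series is the coefficient of `x ^ maxS` after clearing
  rw [coeff_mul_X_pow', if_pos le_rfl, Nat.sub_self, coeff_zero_eq_constantCoeff, map_sum] at hcoeff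
  have hfc : constantCoeff f = MvPolynomial.eval 1 p / MvPolynomial.eval 1 q := by
    rw [hf, map_mul, constantCoeff_inv, constantCoeff_expSubst, constantCoeff_expSubst,
      div_eq_mul_inv]
  rw [← hfc]
  refine hcoeff.trans (Finset.sum_congr rfl fun i _ => ?_)
  rw [coeff_C_mul, coeff_mul_X_pow', if_pos (Nat.sub_le _ _), Nat.sub_sub_self (hle i),
    coeff_expSeries_mul_prod, mul_assoc, Finset.mul_sum]
  congr 1
  refine Finset.sum_congr rfl fun l _ => ?_
  have hpi : ∏ j, pairing lam (D.b i j) ≠ 0 := Finset.prod_ne_zero_iff.2 fun j _ => hlam i j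
  have hl : (l.factorial : ℚ) ≠ 0 := by exact_mod_cast l.factorial_ne_zero
  have hs : ∏ j, -pairing lam (D.b i j) = (-1) ^ D.s i * ∏ j, pairing lam (D.b i j) := by
    rw [Finset.prod_neg]; simp
  have h1 : ((-1 : ℚ) ^ D.s i) * (-1) ^ D.s i = 1 := by rw [← mul_pow]; simp
  have h1' : ((-1 : ℚ) ^ D.s i)⁻¹ = (-1) ^ D.s i := inv_eq_of_mul_eq_one_left h1
  rw [weight, hs, mul_inv, h1']
  field_simp

end RationalSum
end

/-! ### Integer points of polytopes and the Ehrhart polynomial -/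

theorem IsPolytope.exists_abs_le {n : ℕ} {P : Set (Fin n → ℝ)} (hP : IsPolytope P) :
    ∃ R : ℕ, ∀ x ∈ P, ∀ k, |x k| ≤ R := by
  obtain ⟨V, rfl⟩ := hP
  obtain ⟨r, hr⟩ := (V.finite_toSet.isCompact_convexHull (𝕜 := ℝ)).isBounded.exists_norm_le
  obtain ⟨R, hR⟩ := exists_nat_ge r
  exact ⟨R, fun x hx k => (norm_le_pi_norm x k).trans ((hr x hx).trans hR)⟩

theorem IsIntegralPolytope.isPolytope {n : ℕ} {P : Set (Fin n → ℝ)} (hP : IsIntegralPolytope P) :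
    IsPolytope P := by
  classical
  obtain ⟨V, rfl⟩ := hP
  exact ⟨V.image fun α k => (α k : ℝ), by simp⟩

theorem finite_latticePoints {n : ℕ} {P : Set (Fin n → ℝ)} {R : ℕ}
    (hR : ∀ x ∈ P, ∀ k, |x k| ≤ R) : (latticePoints P).Finite := by
  refine (Set.finite_Icc (fun _ : Fin n => -(R : ℤ)) fun _ => (R : ℤ)).subset fun α hα => ?_
  have h : ∀ k, |α k| ≤ (R : ℤ) := fun k => by exact_mod_cast hR _ hα k
  exact ⟨fun k => (abs_le.1 (h k)).1, fun k => (abs_le.1 (h k)).2⟩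

theorem hasValueAtOne_generatingFunction {n : ℕ} {P : Set (Fin n → ℝ)}
    (hP : (latticePoints P).Finite) :
    HasValueAtOne (generatingFunction P) ((latticePoints P).ncard : ℚ) := by
  rw [generatingFunction, finsum_mem_eq_finite_toFinset_sum _ hP, hasValueAtOne_iff]
  have h := HasValueAlong.sum (φ := MvPolynomial.eval (1 : Fin n → ℚ)) hP.toFinset
    (fun α _ => hasValueAtOne_iff.1 (hasValueAtOne_laurentMonomial α))
  rwa [Finset.sum_const, ← Set.ncard_eq_toFinset_card _ hP, nsmul_one] at h

/-- A subspace of dimension `d` of a coordinate space projects injectively to some `d`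
coordinates. -/
theorem exists_coordinates_injective {n : ℕ} (W : Submodule ℝ (Fin n → ℝ)) :
    ∃ (m : ℕ) (e : Fin m → Fin n), m ≤ Module.finrank ℝ W ∧
      ∀ w ∈ W, (∀ j, w (e j) = 0) → w = 0 := by
  let φ : Fin n → Module.Dual ℝ W := fun k => (LinearMap.proj k).comp W.subtype
  obtain ⟨κ, a, ha, hspan, hli⟩ := exists_linearIndependent' ℝ φ
  have : Finite κ := Finite.of_injective a ha
  have : Fintype κ := Fintype.ofFinite κ
  refine ⟨Fintype.card κ, a ∘ (Fintype.equivFin κ).symm, ?_, fun w hw h0 => ?_⟩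
  · exact hli.fintype_card_le_finrank.trans_eq Subspace.dual_finrank_eq
  · funext k
    have hk : φ k ∈ Submodule.span ℝ (Set.range (φ ∘ a)) :=
      hspan ▸ Submodule.subset_span (Set.mem_range_self k)
    have hle : Submodule.span ℝ (Set.range (φ ∘ a)) ≤
        LinearMap.ker (Module.Dual.eval ℝ W ⟨w, hw⟩) := by
      rw [Submodule.span_le]
      rintro _ ⟨j, rfl⟩
      have := h0 (Fintype.equivFin κ j)
      simpa [φ] using this
    simpa [φ] using hle hk

/-- The bound holds because the projection to suitable `dim P` coordinates is injective on `k P`, and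
maps its integer points into a box. -/
theorem ncard_latticePoints_smul_le {n : ℕ} {P : Set (Fin n → ℝ)} {R : ℕ}
    (hR : ∀ x ∈ P, ∀ k, |x k| ≤ R) (k : ℕ) :
    (latticePoints ((k : ℝ) • P)).ncard ≤ (2 * R * k + 1) ^ polytopeDim P := by
  obtain ⟨m, e, hm, hinj⟩ := exists_coordinates_injective (vectorSpan ℝ P)
  let B : Finset (Fin m → ℤ) := Finset.Icc (fun _ => -((R * k : ℕ) : ℤ)) fun _ => ((R * k : ℕ) : ℤ)
  have hB : B.card = (2 * R * k + 1) ^ m := by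
    simp only [B, Pi.card_Icc, Int.card_Icc, Finset.prod_const, Finset.card_univ, Fintype.card_fin]
    congr 1
    rw [mul_assoc]
    omega
  have hmaps : ∀ α ∈ latticePoints ((k : ℝ) • P), α ∘ e ∈ (B : Set (Fin m → ℤ)) := by
    rintro α ⟨x, hx, hxα⟩
    have h : ∀ j, |α j| ≤ ((R * k : ℕ) : ℤ) := fun j => by
      have h1 : (α j : ℝ) = k * x j := (congrFun hxα j).symm
      have h2 : |(α j : ℝ)| ≤ (R * k : ℕ) := by
        rw [h1, abs_mul, Nat.abs_cast, Nat.cast_mul, mul_comm]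
        exact mul_le_mul_of_nonneg_right (hR x hx j) (Nat.cast_nonneg k)
      exact_mod_cast h2
    exact Finset.mem_coe.2 (Finset.mem_Icc.2
      ⟨fun j => (abs_le.1 (h (e j))).1, fun j => (abs_le.1 (h (e j))).2⟩)
  have hinjOn : Set.InjOn (fun α : Fin n → ℤ => α ∘ e) (latticePoints ((k : ℝ) • P)) := by
    rintro α ⟨x, hx, hxα⟩ β ⟨y, hy, hyβ⟩ hαβ
    have h0 : (k : ℝ) • (x - y) = 0 := by
      refine hinj _ (Submodule.smul_mem _ _ (vsub_mem_vectorSpan ℝ hx hy)) fun j => ?_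
      have h1 : (α (e j) : ℝ) = k * x (e j) := (congrFun hxα (e j)).symm
      have h2 : (β (e j) : ℝ) = k * y (e j) := (congrFun hyβ (e j)).symm
      have h3 : α (e j) = β (e j) := congrFun hαβ j
      rw [Pi.smul_apply, Pi.sub_apply, smul_eq_mul, mul_sub, ← h1, ← h2, h3, sub_self]
    funext j
    have h1 : (α j : ℝ) = k * x j := (congrFun hxα j).symm
    have h2 : (β j : ℝ) = k * y j := (congrFun hyβ j).symm
    have h3 := congrFun h0 j
    simp only [Pi.smul_apply, Pi.sub_apply, smul_eq_mul, mul_sub, ← h1, ← h2, Pi.zero_apply] at h3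
    exact_mod_cast sub_eq_zero.1 h3
  have := Set.ncard_le_ncard_of_injOn _ hmaps hinjOn B.finite_toSet
  rw [Set.ncard_coe_finset, hB] at this
  exact this.trans (Nat.pow_le_pow_right (by omega) hm)

/-- A polynomial that grows at most like `k ^ d` on the positive integers has degree at most `d`. -/
theorem Polynomial.natDegree_le_of_abs_eval_le {F : Polynomial ℚ} {R d : ℕ}
    (h : ∀ k : ℕ, 0 < k → |F.eval (k : ℚ)| ≤ (2 * R * k + 1) ^ d) : F.natDegree ≤ d := by
  by_contra! hd
  let Q : Polynomial ℚ := (C (2 * R : ℚ) * X + C 1) ^ d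
  have hQ : ∀ k : ℕ, Q.eval (k : ℚ) = (2 * R * k + 1) ^ d := fun k => by simp [Q]
  have hQ0 : Q ≠ 0 := fun h0 => by simpa [h0] using hQ 0
  have hdeg : Q.degree < F.degree := by
    refine lt_of_le_of_lt (degree_le_of_natDegree_le (natDegree_pow_le_of_le d
      (natDegree_linear_le (a := (2 * R : ℚ)) (b := 1)))) ?_
    rw [mul_one]
    exact (lt_of_lt_of_le (by exact_mod_cast hd) (degree_eq_natDegree
      (fun h0 : F = 0 => by simp [h0] at hd)).ge)
  have ht := (abs_div_tendsto_atTop_atTop_of_degree_gt F Q hdeg hQ0).comp tendsto_natCast_atTop_atTop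
  obtain ⟨k, hk1, hk⟩ := ((ht.eventually_gt_atTop 1).and (Filter.eventually_gt_atTop 0)).exists
  have hpos : (0 : ℚ) < (2 * R * k + 1) ^ d := by positivity
  simp only [Function.comp_apply, hQ] at hk1
  rw [abs_div, abs_of_pos hpos, one_lt_div hpos] at hk1
  exact absurd (h k hk) (not_le.2 hk1)

theorem pairing_add_smul {n : ℕ} (lam : Fin n → ℚ) (a v : Fin n → ℤ) (k : ℕ) :
    pairing lam (a + ((k : ℤ) - 1) • v) = pairing lam (a - v) + k * pairing lam v := by
  simp only [pairing, Finset.mul_sum, ← Finset.sum_add_distrib]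
  refine Finset.sum_congr rfl fun j _ => ?_
  simp only [Pi.add_apply, Pi.smul_apply, Pi.sub_apply, smul_eq_mul]
  push_cast
  ring

/-- Binomial expansion of a polynomial in `γ + k β`, ordered by the powers of `k`. -/
theorem sum_mul_add_pow {S s : ℕ} (hs : s ≤ S) (w : ℕ → ℚ) (γ β k : ℚ) :
    ∑ l ∈ Finset.range (s + 1), w l * (γ + k * β) ^ l =
      ∑ m ∈ Finset.range (S + 1), (β ^ m * ∑ l ∈ Finset.Icc m s,
        (l.choose m : ℚ) * w l * γ ^ (l - m)) * k ^ m := by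
  simp only [Finset.mul_sum, Finset.sum_mul]
  rw [Finset.sum_comm' (t' := Finset.range (s + 1)) (s' := fun l => Finset.range (l + 1))
    (by simp only [Finset.mem_range, Finset.mem_Icc]; omega)]
  refine Finset.sum_congr rfl fun l _ => ?_
  rw [add_comm γ, add_pow, Finset.mul_sum]
  refine Finset.sum_congr rfl fun m _ => ?_
  rw [mul_pow]
  ring

/-- The value formula, expanded in powers of `k`, with the coefficients beyond `dim P` discarded: they
vanish by `ncard_latticePoints_smul_le`. -/
theorem RationalSum.isEhrhartPolynomial (D : RationalSum) (v : Fin D.N → Fin D.n → ℤ)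
    (P : Set (Fin D.n → ℝ)) (hP : IsIntegralPolytope P)
    (hg : ∀ k : ℕ, 0 < k →
      generatingFunction ((k : ℝ) • P) = (D.dilate v k).toRationalFunction)
    (lam : Fin D.n → ℚ) (hlam : ∀ i j, pairing lam (D.b i j) ≠ 0) :
    IsEhrhartPolynomial P
      (∑ m ∈ Finset.range (min D.maxS (polytopeDim P) + 1),
        Polynomial.C
          (∑ i, D.ε i * pairing lam (v i) ^ m *
            ∑ l ∈ Finset.Icc m (D.s i),
              (l.choose m : ℚ) * D.weight lam i l *
                pairing lam (D.a i - v i) ^ (l - m)) *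
        Polynomial.X ^ m) := by
  obtain ⟨R, hR⟩ := hP.isPolytope.exists_abs_le
  set co : ℕ → ℚ := fun m => ∑ i, D.ε i * pairing lam (v i) ^ m *
    ∑ l ∈ Finset.Icc m (D.s i), (l.choose m : ℚ) * D.weight lam i l *
      pairing lam (D.a i - v i) ^ (l - m) with hco
  set F : Polynomial ℚ := ∑ m ∈ Finset.range (D.maxS + 1),
    Polynomial.C (co m) * Polynomial.X ^ m with hF
  have heval : ∀ k : ℕ, 0 < k → F.eval (k : ℚ) = ((latticePoints ((k : ℝ) • P)).ncard : ℚ) := by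
    intro k hk
    have hfin : (latticePoints ((k : ℝ) • P)).Finite := by
      refine finite_latticePoints (R := k * R) ?_
      rintro _ ⟨x, hx, rfl⟩ j
      simp only [Pi.smul_apply, smul_eq_mul, abs_mul, Nat.abs_cast, Nat.cast_mul]
      exact mul_le_mul_of_nonneg_left (hR x hx j) (Nat.cast_nonneg k)
    have hval := hasValueAtOne_generatingFunction hfin
    rw [hg k hk] at hval
    have hsum : ((latticePoints ((k : ℝ) • P)).ncard : ℚ) =
        ∑ i, D.ε i * ∑ l ∈ Finset.range (D.s i + 1), D.weight lam i l *
          pairing lam (D.a i + ((k : ℤ) - 1) • v i) ^ l :=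
      (D.dilate v k).eq_sum_of_hasValueAtOne hval (lam := lam) hlam
    have hle : ∀ i, D.s i ≤ D.maxS := fun i => Finset.le_sup (f := D.s) (Finset.mem_univ i)
    rw [hsum]
    simp only [pairing_add_smul, sum_mul_add_pow (hle _), Finset.mul_sum]
    rw [Finset.sum_comm, hF, Polynomial.eval_finsetSum]
    refine Finset.sum_congr rfl fun m _ => ?_
    simp only [Polynomial.eval_mul, Polynomial.eval_C, Polynomial.eval_pow, Polynomial.eval_X, hco,
      Finset.sum_mul, Finset.mul_sum]
    refine Finset.sum_congr rfl fun i _ => Finset.sum_congr rfl fun l _ => ?_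
    ring
  have hdeg : F.natDegree ≤ polytopeDim P := by
    refine Polynomial.natDegree_le_of_abs_eval_le (R := R) fun k hk => ?_
    rw [heval k hk, Nat.abs_cast]
    exact_mod_cast ncard_latticePoints_smul_le hR k
  have hcoeff : ∀ m ∈ Finset.range (D.maxS + 1), F.coeff m = co m := fun m hm => by
    rw [hF, Polynomial.finsetSum_coeff]
    simp only [Polynomial.coeff_C_mul_X_pow]
    rw [Finset.sum_ite_eq (Finset.range (D.maxS + 1)) m, if_pos hm]
  have hFeq : F = ∑ m ∈ Finset.range (min D.maxS (polytopeDim P) + 1),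
      Polynomial.C (co m) * Polynomial.X ^ m := by
    refine (Finset.sum_subset (Finset.range_mono (by omega)) fun m hm hm' => ?_).symm
    rw [← hcoeff m hm, Polynomial.coeff_eq_zero_of_natDegree_lt, Polynomial.C_0, zero_mul]
    simp only [Finset.mem_range] at hm hm'
    omega
  rw [← hFeq]
  exact heval

/-! ### Scaled Todd polynomials -/

noncomputable section

theorem toddSeries_mul_mk :
    toddSeries * (PowerSeries.mk fun m => (-1 : ℚ) ^ m / (m + 1).factorial) = 1 :=
  PowerSeries.inv_mul_cancel _ (by simp)

/-- The coefficient of `x ^ m` in `∏_{j' < j} h (-F β_j' x)`, where `h` is the Todd series.  If `F`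
is divisible by `(k + 1)!` for `1 ≤ k ≤ m`, then it is an integer. -/
def scaledTodd (F : ℕ) (β : ℕ → ℤ) (j m : ℕ) : ℚ :=
  PowerSeries.coeff m (∏ j' ∈ Finset.range j, PowerSeries.rescale (-(F * β j') : ℚ) toddSeries)

theorem scaledTodd_zero (F : ℕ) (β : ℕ → ℤ) (m : ℕ) :
    scaledTodd F β 0 m = if m = 0 then 1 else 0 := by
  simp [scaledTodd, PowerSeries.coeff_one]

/-- Division by one factor `(1 - exp (F β_j x)) / (-F β_j x)`, coefficient by coefficient. -/
theorem scaledTodd_succ (F : ℕ) (β : ℕ → ℤ) (j m : ℕ) :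
    scaledTodd F β (j + 1) m = scaledTodd F β j m - ∑ k ∈ Finset.range m,
      ((F * β j) ^ (k + 1) / (k + 2).factorial : ℚ) * scaledTodd F β (j + 1) (m - (k + 1)) := by
  have h : scaledTodd F β j m = ∑ k ∈ Finset.range (m + 1),
      ((F * β j) ^ k / (k + 1).factorial : ℚ) * scaledTodd F β (j + 1) (m - k) := by
    have h1 := congrArg (PowerSeries.rescale (-(F * β j) : ℚ)) toddSeries_mul_mk
    rw [map_mul, map_one] at h1
    have h2 : (∏ j' ∈ Finset.range j, PowerSeries.rescale (-(F * β j') : ℚ) toddSeries) =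
        PowerSeries.rescale (-(F * β j) : ℚ)
          (PowerSeries.mk fun m => (-1 : ℚ) ^ m / (m + 1).factorial) *
        ∏ j' ∈ Finset.range (j + 1), PowerSeries.rescale (-(F * β j') : ℚ) toddSeries := by
      rw [Finset.prod_range_succ, mul_comm, mul_assoc, h1, mul_one]
    rw [scaledTodd, h2, PowerSeries.coeff_mul, Finset.Nat.sum_antidiagonal_eq_sum_range_succ_mk]
    refine Finset.sum_congr rfl fun k _ => ?_
    simp only [scaledTodd, PowerSeries.coeff_rescale, PowerSeries.coeff_mk]
    rw [← mul_div_assoc, ← mul_pow, neg_mul_neg, mul_one]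
  rw [h, Finset.sum_range_succ']
  simp

/-- Scaling all arguments by `F` scales the Todd polynomial of degree `m` by `F ^ m`. -/
theorem scaledTodd_eq (F : ℕ) (β : ℕ → ℤ) (s m : ℕ) :
    scaledTodd F β s m = F ^ m * todd m (fun j : Fin s => (-(β j) : ℚ)) := by
  rw [scaledTodd, todd, ← PowerSeries.coeff_rescale, Finset.prod_range]
  congr 1
  rw [map_prod]
  refine Finset.prod_congr rfl fun j _ => ?_
  rw [PowerSeries.rescale_rescale]
  rw [neg_mul, mul_comm]

/-- Growth of the coefficients under division by a power series with constant term `1`. -/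
theorem abs_sub_sum_le {c d e : ℕ → ℚ} {A B : ℚ} {s : ℕ} (hA : 1 ≤ A)
    (hd : ∀ m ≤ s, |d m| ≤ B) (he : ∀ k < s, |e k| ≤ A - 1)
    (hc : ∀ m, c m = d m - ∑ k ∈ Finset.range m, e k * c (m - (k + 1))) (m : ℕ) (hm : m ≤ s)
    (K : ℕ) (hK : K ≤ m) :
    |d m - ∑ k ∈ Finset.range K, e k * c (m - (k + 1))| ≤ B * A ^ m := by
  induction m using Nat.strong_induction_on generalizing K with
  | _ m ih =>
    have hcm : ∀ i < m, |c i| ≤ B * A ^ i := fun i hi => by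
      rw [hc i]; exact ih i hi (by omega) i le_rfl
    have h1 : |∑ k ∈ Finset.range K, e k * c (m - (k + 1))| ≤
        ∑ k ∈ Finset.range m, (A - 1) * (B * A ^ (m - 1 - k)) := by
      refine (Finset.abs_sum_le_sum_abs _ _).trans
        ((Finset.sum_le_sum_of_subset_of_nonneg (Finset.range_mono hK)
          fun _ _ _ => abs_nonneg _).trans (Finset.sum_le_sum fun k hk => ?_))
      have hk' := Finset.mem_range.1 hk
      rw [abs_mul, show m - 1 - k = m - (k + 1) by omega]
      exact mul_le_mul (he k (by omega)) (hcm _ (by omega)) (abs_nonneg _) (by linarith)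
    have h2 : ∑ k ∈ Finset.range m, (A - 1) * (B * A ^ (m - 1 - k)) = B * (A ^ m - 1) := by
      rw [Finset.sum_range_reflect (fun i => (A - 1) * (B * A ^ i)), ← mul_geom_sum A m]
      simp only [Finset.mul_sum]
      exact Finset.sum_congr rfl fun k _ => by ring
    have h3 := abs_sub (d m) (∑ k ∈ Finset.range K, e k * c (m - (k + 1)))
    have h4 := hd m hm
    rw [h2] at h1
    linarith

theorem abs_scaledTodd_le {F : ℕ} {β : ℕ → ℤ} {A : ℚ} {s : ℕ} (hA : 1 ≤ A) (j : ℕ)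
    (he : ∀ i < j, ∀ k < s, |((F * β i) ^ (k + 1) / (k + 2).factorial : ℚ)| ≤ A - 1)
    (m : ℕ) (hm : m ≤ s) : |scaledTodd F β j m| ≤ A ^ (j * s) := by
  induction j generalizing m with
  | zero => rw [scaledTodd_zero]; split_ifs <;> simp
  | succ j ih =>
    have h := abs_sub_sum_le hA (ih fun i hi => he i (by omega))
      (he j (by omega)) (scaledTodd_succ F β j) m hm m le_rfl
    rw [← scaledTodd_succ] at h
    refine h.trans ?_
    rw [← pow_add]
    exact pow_le_pow_right₀ hA (by rw [add_mul]; omega)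

/-- A bound for the intermediate results of the division by one factor. -/
theorem abs_scaledTodd_sub_sum_le {F : ℕ} {β : ℕ → ℤ} {A : ℚ} {s : ℕ} (hA : 1 ≤ A) (j : ℕ)
    (he : ∀ i ≤ j, ∀ k < s, |((F * β i) ^ (k + 1) / (k + 2).factorial : ℚ)| ≤ A - 1)
    (m : ℕ) (hm : m ≤ s) (K : ℕ) (hK : K ≤ m) :
    |scaledTodd F β j m - ∑ k ∈ Finset.range K,
      ((F * β j) ^ (k + 1) / (k + 2).factorial : ℚ) * scaledTodd F β (j + 1) (m - (k + 1))| ≤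
      A ^ ((j + 1) * s) := by
  refine (abs_sub_sum_le hA
    (abs_scaledTodd_le hA j fun i hi => he i hi.le)
    (he j le_rfl) (scaledTodd_succ F β j) m hm K hK).trans ?_
  rw [← pow_add]
  exact pow_le_pow_right₀ hA (by rw [add_mul]; omega)

end

/-! ### Subroutines

Use of the arrays: `0` input, `1` output, `2` a power series, `3` a table of coefficients.  The other
arrays serve as scalar variables (cell `0`):
`4` dimension `n`, `5` number `N` of summands, `6` address of the current summand in the input,
`7` the number `ξ`, `8` result of a pairing, `9`, `10`, `11`, `12` loop counters, `13` the number `s` of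
denominator factors, `14` the factorial `F = (s + 1)!`, `15` and `24` running powers, `16` a running
factorial, `17` the product of the `-β_j`, `18` the pairing with `a_i`, `19` and `20` numerator and
denominator of the accumulated sum, `21` output address, `22` start address of a pairing,
`23` the power `F ^ s`, `25` and `26` numerator and denominator of a weight.
-/

namespace RAM

/-- The pairing of the vector in array `1` with the vector that starts at address `e` of the input:
`t := ∑_k out[k] * in[q + k]`. -/
def dotProg (e : Expr) : Prog :=
  .seq (setVar 22 e) (.seq (setVar 8 (.const 0)) (forLoop 9 (var 4)
    (setVar 8 (.add (var 8) (.mul (.read 1 (var 9)) (.read 0 (.add (var 22) (var 9))))))))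

/-- Computes the number `s`, its factorial `F = (s + 1)!`, and puts the coefficients of the power
series `1` into array `2`. -/
def initSeriesProg : Prog :=
  .seq (setVar 13 (.read 0 (.add (var 6) (.const 2)))) (.seq (setVar 14 (.const 1)) (.seq
    (forLoop 9 (.add (var 13) (.const 1))
      (.seq (setVar 14 (.mul (var 14) (.add (var 9) (.const 1))))
        (.assign 2 (var 9) (.const 0))))
    (.assign 2 (.const 0) (.const 1))))

/-- The table `E[k] = (F t)^k / (k+1)!` in array `3`. -/
def tableProg : Prog :=
  .seq (setVar 15 (.const 1)) (.seq (setVar 16 (.const 1))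
    (forLoop 9 (.add (var 13) (.const 1))
      (.seq (.assign 3 (var 9) (.div (var 15) (var 16)))
        (.seq (setVar 15 (.mul (var 15) (.mul (var 14) (var 8))))
          (setVar 16 (.mul (var 16) (.add (var 9) (.const 2))))))))

/-- Division of the power series in array `2` by the power series in array `3`, in place. -/
def divideProg : Prog :=
  forLoop 12 (.add (var 13) (.const 1)) (forLoop 9 (var 12)
    (.assign 2 (var 12) (.sub (.read 2 (var 12))
      (.mul (.read 3 (.add (var 9) (.const 1)))
        (.read 2 (.sub (var 12) (.add (var 9) (.const 1))))))))

variable {L b : ℕ} {σ : Store}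

theorem wp_dotProg {e : Expr} {n : ℕ} {x q : ℤ} (he : e.eval σ = q) (hn : σ 4 0 = n)
    (hnL : n ≤ L) (hL : L + 1 ≤ b) (hpow : ∀ k < n, σ 1 k = x ^ k) (hq : intSize q ≤ b)
    (hsz : ∀ m ≤ n, intSize (∑ k ∈ Finset.range m, x ^ k * σ 0 (q + k)) ≤ b) :
    WP L b (dotProg e) (fun τ => τ 8 0 = ∑ k ∈ Finset.range n, x ^ k * σ 0 (q + k)) σ := by
  refine wp_seq (wp_setVar (by rwa [he]) (wp_seq (wp_setVar (hsz 0 (Nat.zero_le n)) ?_)))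
  refine wp_forLoop (n := n) (fun m τ => τ 8 0 = ∑ k ∈ Finset.range m, x ^ k * σ 0 (q + k))
    hnL hL (by decide) ?_ ?_ ?_ ?_
  · intro τ hτ
    simp [Expr.eval, hτ 4 (by decide) (by decide), write_apply, hn]
  · simp [write_apply, Expr.eval]
  · intro k hk τ hf hk0 hI
    have h0 : τ 0 = σ 0 := by
      rw [hf 0 (by decide) (by decide), write_of_ne _ _ _ (by decide), write_of_ne _ _ _ (by decide)]
    have h1 : τ 1 = σ 1 := by
      rw [hf 1 (by decide) (by decide), write_of_ne _ _ _ (by decide), write_of_ne _ _ _ (by decide)]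
    have h22 : τ 22 0 = q := by
      rw [hf 22 (by decide) (by decide)]; simp [write_apply, Expr.eval, he]
    have hval : (Expr.add (var 8) (.mul (.read 1 (var 9)) (.read 0 (.add (var 22) (var 9))))).eval τ
        = ∑ k ∈ Finset.range (k + 1), x ^ k * σ 0 (q + k) := by
      simp [Expr.eval, hk0, h0, h1, h22, hI, hpow k hk, Finset.sum_range_succ]
    refine wp_setVar (by rw [hval]; exact hsz _ hk) ?_
    rw [hval]
    simp [write_apply]
  · intro τ _ h
    exact h

theorem wp_initSeriesProg {s : ℕ} (hs : σ 0 (σ 6 0 + 2) = s)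
    (hsL : s + 1 ≤ L) (hL : L + 1 ≤ b) (hfac : ∀ k ≤ s + 1, intSize (k.factorial : ℤ) ≤ b) :
    WP L b initSeriesProg (fun τ => τ 13 0 = s ∧ τ 14 0 = ((s + 1).factorial : ℤ) ∧
      ∀ m ≤ s, τ 2 m = if m = 0 then 1 else 0) σ := by
  have hb1 : intSize 1 ≤ b := (intSize_natCast_le 1).trans (by omega)
  have hb0 : intSize 0 ≤ b := (intSize_natCast_le 0).trans (by omega)
  have hv : (Expr.read 0 (.add (var 6) (.const 2))).eval σ = s := by simp [Expr.eval, hs]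
  refine wp_seq (wp_setVar (by rw [hv]; exact (intSize_natCast_le s).trans (by omega)) ?_)
  refine wp_seq (wp_setVar hb1 ?_)
  refine wp_seq (wp_forLoop (n := s + 1)
    (fun m τ => τ 14 0 = (m.factorial : ℤ) ∧ ∀ k < m, τ 2 k = 0) hsL hL (by decide) ?_ ?_ ?_ ?_)
  · intro τ hf
    simp [Expr.eval, hf 13 (by decide) (by decide), write_apply, hs]
  · simp [write_apply, Expr.eval]
  · rintro k hk τ hf hk0 ⟨h14, h2⟩
    have hval : (Expr.mul (var 14) (.add (var 9) (.const 1))).eval τ =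
        ((k + 1).factorial : ℤ) := by
      simp [Expr.eval, h14, hk0, Nat.factorial_succ, mul_comm]
    refine wp_seq (wp_setVar (by rw [hval]; exact hfac _ hk) (wp_assign hb0 ⟨?_, fun i hi => ?_⟩))
    · simp [write_apply, hval]
    · simp only [write_apply, Expr.eval]
      by_cases hik : i = k
      · simp [hik, hk0]
      · have : i < k := by omega
        simp [h2 i this]
  · rintro τ hf ⟨h14, h2⟩
    refine wp_assign hb1 ⟨?_, ?_, fun m hm => ?_⟩
    · simp [write_apply, hf 13 (by decide) (by decide), Expr.eval, hs]
    · simpa [write_apply] using h14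
    · rcases Nat.eq_zero_or_pos m with rfl | hm0
      · simp [write_apply, Expr.eval]
      · have : (m : ℤ) ≠ 0 := by omega
        simp [write_apply, Expr.eval, h2 m (by omega), hm0.ne']

theorem wp_tableProg {s F : ℕ} {t : ℤ} (hs : σ 13 0 = s) (hF : σ 14 0 = F) (ht : σ 8 0 = t)
    (hFs : F = (s + 1).factorial) (hsL : s + 1 ≤ L) (hL : L + 1 ≤ b)
    (hpow : ∀ k ≤ s + 1, intSize (((F : ℤ) * t) ^ k) ≤ b)
    (hfac : ∀ k ≤ s + 2, intSize (k.factorial : ℤ) ≤ b) :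
    WP L b tableProg (fun τ => ∀ k ≤ s, (τ 3 k : ℚ) = ((F : ℚ) * t) ^ k / (k + 1).factorial) σ := by
  have hb1 : intSize 1 ≤ b := (intSize_natCast_le 1).trans (by omega)
  refine wp_seq (wp_setVar hb1 (wp_seq (wp_setVar hb1 ?_)))
  refine wp_forLoop (n := s + 1) (fun m τ => τ 15 0 = ((F : ℤ) * t) ^ m ∧
    τ 16 0 = ((m + 1).factorial : ℤ) ∧
    ∀ k < m, (τ 3 k : ℚ) = ((F : ℚ) * t) ^ k / (k + 1).factorial) hsL hL (by decide) ?_ ?_ ?_ ?_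
  · intro τ hf
    simp [Expr.eval, hf 13 (by decide) (by decide), write_apply, hs]
  · simp [write_apply, Expr.eval]
  · rintro k hk τ hf hk0 ⟨h15, h16, h3⟩
    have h14 : τ 14 0 = F := by
      rw [hf 14 (by decide) (by decide)]; simp [write_apply, hF]
    have h8 : τ 8 0 = t := by
      rw [hf 8 (by decide) (by decide)]; simp [write_apply, ht]
    refine wp_seq (wp_assign ?_ (wp_seq (wp_setVar ?_ (wp_setVar ?_ ⟨?_, ?_, fun i hi => ?_⟩))))
    · refine (intSize_div_le _ _).trans ?_
      simpa [Expr.eval, h15] using hpow k (by omega)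
    · have := hpow (k + 1) (by omega)
      simpa [Expr.eval, write_apply, h15, h14, h8, pow_succ] using this
    · have := hfac (k + 2) (by omega)
      rw [Nat.factorial_succ (k + 1)] at this
      push_cast at this
      simpa [Expr.eval, write_apply, h16, hk0, mul_comm, add_assoc] using this
    · simp [Expr.eval, write_apply, h15, h14, h8, pow_succ]
    · rw [Nat.factorial_succ (k + 1)]
      simp [Expr.eval, write_apply, h16, hk0, mul_comm, add_assoc]
    · by_cases hik : i = k
      · subst hik
        simp only [write_apply, Expr.eval, hk0, h15, h16]
        -- the division is exact, because `(i + 1)!` divides `F`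
        have hdvd : (((i + 1).factorial : ℕ) : ℤ) ∣ ((F : ℤ) * t) ^ i := by
          rcases Nat.eq_zero_or_pos i with rfl | hi0
          · simp
          · rw [mul_pow]
            refine Dvd.dvd.mul_right ((Int.natCast_dvd_natCast.2 ?_).trans
              (dvd_pow_self _ hi0.ne')) _
            rw [hFs]
            exact Nat.factorial_dvd_factorial (by omega)
        simp only [Nat.reduceEqDiff, false_and, if_false, if_true, and_self]
        rw [Int.cast_div hdvd (by exact_mod_cast (i + 1).factorial_ne_zero)]
        push_cast
        rfl
      · have : i < k := by omega
        simp [write_apply, Expr.eval, hk0, hik, h3 i this]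
  · exact fun τ _ h k hk => h.2.2 k (by omega)

/-- The invariant of the outer loop: the coefficients below `M` are those of the quotient `c`, the
others still those of the dividend `d`. -/
theorem wp_divideProg {s : ℕ} {c d e : ℕ → ℚ} (hs : σ 13 0 = s) (hsL : s + 1 ≤ L) (hL : L + 1 ≤ b)
    (he : ∀ k < s, (σ 3 (k + 1) : ℚ) = e k) (hd : ∀ m ≤ s, (σ 2 m : ℚ) = d m)
    (hc : ∀ m, c m = d m - ∑ k ∈ Finset.range m, e k * c (m - (k + 1)))
    (hsz : ∀ m ≤ s, ∀ K ≤ m, ∀ z : ℤ,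
      (z : ℚ) = d m - ∑ k ∈ Finset.range K, e k * c (m - (k + 1)) → intSize z ≤ b) :
    WP L b divideProg (fun τ => ∀ m ≤ s, (τ 2 m : ℚ) = c m) σ := by
  refine wp_forLoop (n := s + 1) (fun M τ => (∀ m < M, (τ 2 m : ℚ) = c m) ∧
    ∀ m, M ≤ m → m ≤ s → (τ 2 m : ℚ) = d m) hsL hL (by decide) ?_ ?_ ?_ ?_
  · intro τ hf
    simp [Expr.eval, hf 13 (by decide) (by decide), hs]
  · simpa [write_apply] using hd
  · rintro M hM τ hf hM0 ⟨hlt, hge⟩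
    refine wp_forLoop (n := M) (fun K ρ => (∀ m < M, (ρ 2 m : ℚ) = c m) ∧
      (∀ m, M + 1 ≤ m → m ≤ s → (ρ 2 m : ℚ) = d m) ∧
      (ρ 2 M : ℚ) = d M - ∑ k ∈ Finset.range K, e k * c (M - (k + 1)))
      (by omega) hL (by decide) ?_ ?_ ?_ ?_
    · intro ρ hf'
      simp [Expr.eval, hf' 12 (by decide) (by decide), hM0]
    · refine ⟨?_, ?_, ?_⟩
      · simpa [write_apply] using hlt
      · exact fun m hm hm' => by simpa [write_apply] using hge m (by omega) hm'
      · simpa [write_apply] using hge M le_rfl (by omega)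
    · rintro K hK ρ hf' hK0 ⟨h1, h2, h3⟩
      have h12 : ρ 12 0 = M := by rw [hf' 12 (by decide) (by decide), hM0]
      have hE : (ρ 3 (K + 1) : ℚ) = e K := by
        rw [hf' 3 (by decide) (by decide), hf 3 (by decide) (by decide), he K (by omega)]
      have hsub : (M : ℤ) - (K + 1) = ((M - (K + 1) : ℕ) : ℤ) := by omega
      have hval : (((Expr.sub (.read 2 (var 12)) (.mul (.read 3 (.add (var 9) (.const 1)))
          (.read 2 (.sub (var 12) (.add (var 9) (.const 1)))))).eval ρ : ℤ) : ℚ) =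
          d M - ∑ k ∈ Finset.range (K + 1), e k * c (M - (k + 1)) := by
        simp only [Expr.eval, h12, hK0, hsub]
        push_cast
        rw [h3, hE, h1 _ (by omega), Finset.sum_range_succ]
        ring
      refine wp_assign (hsz M (by omega) (K + 1) (by omega) _ hval) ⟨fun m hm => ?_,
        fun m hm hm' => ?_, ?_⟩
      · have : m ≠ M := by omega
        simpa [write_apply, Expr.eval, h12, this] using h1 m hm
      · have : m ≠ M := by omega
        simpa [write_apply, Expr.eval, h12, this] using h2 m hm hm'
      · rw [← hval]
        simp [write_apply, Expr.eval, h12]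
    · rintro ρ hf' ⟨h1, h2, h3⟩
      refine ⟨fun m hm => ?_, fun m hm hm' => ?_⟩
      · rcases Nat.lt_succ_iff_lt_or_eq.1 hm with h | rfl
        · simpa [write_apply] using h1 m h
        · rw [hc m, ← h3]; simp [write_apply]
      · simpa [write_apply] using h2 m hm hm'
  · exact fun τ _ h m hm => h.1 m (by omega)

end RAM

namespace RAM

/-- The pairing of `(1, x, x², …)` with the vector of `n` numbers that starts at address `q`. -/
def dotAt (x : ℤ) (f : ℤ → ℤ) (n : ℕ) (q : ℤ) : ℤ := ∑ k ∈ Finset.range n, x ^ k * f (q + k)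

/-! ### Bounds for the intermediate results -/

/-- A bound for the length of `ξ`. -/
def xiBits (S : ℕ) : ℕ := 3 * S + 1

/-- A bound for the length of the pairings with `(1, ξ, ξ², …)`. -/
def dotBits (S : ℕ) : ℕ := xiBits S * S + 2 * S

/-- A bound for the length of the factorials. -/
def facBits (S : ℕ) : ℕ := (S + 2) * (S + 2)

/-- A bound for the length of the entries of the tables of powers. -/
def powBits (S : ℕ) : ℕ := (facBits S + dotBits S) * (S + 1)

/-- A bound for the length of the scaled Todd polynomials. -/
def toddBits (S : ℕ) : ℕ := (powBits S + 1) * (S * S)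

/-- A bound for the length of the numerators of the weights. -/
def numBits (S : ℕ) : ℕ := toddBits S + facBits S * (S + 1) + dotBits S * S

/-- A bound for the length of the denominators of the weights. -/
def denBits (S : ℕ) : ℕ :=
  facBits S * (S + 1) + facBits S + (dotBits S * S + dotBits S * S)

/-- A bound for the growth of the accumulated fraction by one summand. -/
def termBits (S : ℕ) : ℕ := S + numBits S + denBits S + dotBits S * (S + 1) + 1

/-- A bound for the length of all numbers in the memory. -/
def bitBound (S : ℕ) : ℕ :=
  S + xiBits S * (S + 1) + dotBits S + facBits S + powBits S + toddBits S + numBits S + denBits S +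
    termBits S * ((S + 1) * (S + 1)) + 10 * (S + 1) * (S + 1) + dotBits S * (S + 1) +
    facBits S * (S + 1) + 10

section

variable {R : Type*} [CommRing R] [LinearOrder R] [IsStrictOrderedRing R]

theorem abs_mul_le_two_pow {y z : R} {d e : ℕ} (hy : |y| ≤ 2 ^ d) (hz : |z| ≤ 2 ^ e) :
    |y * z| ≤ 2 ^ (d + e) := by
  rw [abs_mul, pow_add]
  exact mul_le_mul hy hz (abs_nonneg _) (by positivity)

theorem abs_pow_le_two_pow {y : R} {d k K : ℕ} (hy : |y| ≤ 2 ^ d) (hk : k ≤ K) :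
    |y ^ k| ≤ 2 ^ (d * K) := by
  rw [abs_pow, pow_mul]
  exact (pow_le_pow_left₀ (abs_nonneg _) hy k).trans
    (pow_le_pow_right₀ (one_le_pow₀ (by norm_num)) hk)

theorem abs_prod_le_two_pow {y : ℕ → R} {d m M : ℕ} (hy : ∀ j < m, |y j| ≤ 2 ^ d) (hm : m ≤ M) :
    |∏ j ∈ Finset.range m, y j| ≤ 2 ^ (d * M) := by
  rw [Finset.abs_prod, pow_mul]
  refine (Finset.prod_le_prod (fun _ _ => abs_nonneg _)
    fun j hj => hy j (Finset.mem_range.1 hj)).trans ?_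
  rw [Finset.prod_const, Finset.card_range]
  exact pow_le_pow_right₀ (one_le_pow₀ (by norm_num)) hm

theorem abs_sum_le_two_pow {y : ℕ → R} {d m M : ℕ} (hy : ∀ j < m, |y j| ≤ 2 ^ d) (hm : m ≤ M) :
    |∑ j ∈ Finset.range m, y j| ≤ 2 ^ (d + M) := by
  refine (Finset.abs_sum_le_sum_abs _ _).trans
    ((Finset.sum_le_sum fun j hj => hy j (Finset.mem_range.1 hj)).trans ?_)
  rw [Finset.sum_const, Finset.card_range, nsmul_eq_mul, pow_add, mul_comm]
  refine mul_le_mul_of_nonneg_left ?_ (by positivity)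
  exact_mod_cast hm.trans Nat.lt_two_pow_self.le

end

theorem abs_dotAt_le {S n : ℕ} {x : ℤ} {f : ℤ → ℤ} (hx : |x| ≤ 2 ^ xiBits S)
    (hf : ∀ y, |f y| ≤ 2 ^ S) (hn : n ≤ S) (q : ℤ) : |dotAt x f n q| ≤ 2 ^ dotBits S := by
  have h := abs_sum_le_two_pow (y := fun k => x ^ k * f (q + k)) (m := n)
    (fun k hk => abs_mul_le_two_pow (abs_pow_le_two_pow hx (hk.le.trans hn)) (hf _)) hn
  rwa [add_assoc, ← two_mul] at h

theorem abs_factorial_le {S k : ℕ} (hk : k ≤ S + 2) : |(k.factorial : ℤ)| ≤ 2 ^ facBits S := by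
  rw [Nat.abs_cast, facBits, pow_mul]
  have h1 : k.factorial ≤ (2 ^ (S + 2)) ^ (S + 2) :=
    (Nat.factorial_le hk).trans ((Nat.factorial_le_pow _).trans
      (Nat.pow_le_pow_left Nat.lt_two_pow_self.le _))
  exact_mod_cast h1

/-- The contribution of one denominator factor `1 - z^b`: with `t = ⟨lam, b⟩`, the products in the
variables `17` and `23` get the factors `-t` and `F`, and the power series in array `2` is
multiplied by the Todd series of `-F t x`. -/
def toddStepProg : Prog :=
  .seq (dotProg (.add (.add (.add (var 6) (.const 3)) (var 4)) (.mul (var 11) (var 4))))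
    (.seq (setVar 17 (.mul (var 17) (.sub (.const 0) (var 8))))
    (.seq (setVar 23 (.mul (var 23) (var 14)))
    (.seq tableProg divideProg)))

/-- The Todd polynomials of one summand. -/
def toddProg : Prog :=
  .seq (setVar 17 (.const 1)) (.seq (setVar 23 (.const 1)) (forLoop 11 (var 13) toddStepProg))

variable {b S : ℕ} {σ : Store}

/-- The entries of the table of coefficients of the divisor are bounded. -/
theorem abs_table_le {s : ℕ} {β : ℕ → ℤ} (hsS : s ≤ S) (hβ : ∀ i, |β i| ≤ 2 ^ dotBits S) (i : ℕ) :
    ∀ k < s, |((((s + 1).factorial : ℕ) * β i) ^ (k + 1) / (k + 2).factorial : ℚ)| ≤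
      (2 ^ powBits S + 1) - 1 := by
  intro k hk
  rw [add_sub_cancel_right, abs_div, Nat.abs_cast]
  refine (div_le_self (abs_nonneg _) (by exact_mod_cast Nat.factorial_pos _)).trans ?_
  have h : |(((s + 1).factorial : ℤ) * β i) ^ (k + 1)| ≤ 2 ^ powBits S :=
    abs_pow_le_two_pow (abs_mul_le_two_pow (abs_factorial_le (by omega)) (hβ i)) (by omega)
  exact_mod_cast h

theorem pow_le_two_pow_toddBits {s j : ℕ} (hsS : s ≤ S) (hj : j ≤ s) :
    ((2 : ℚ) ^ powBits S + 1) ^ (j * s) ≤ 2 ^ toddBits S := by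
  have hA : (2 : ℚ) ^ powBits S + 1 ≤ 2 ^ (powBits S + 1) := by
    rw [pow_succ, mul_two]
    exact add_le_add le_rfl (one_le_pow₀ (by norm_num))
  refine (pow_le_pow_left₀ (by positivity) hA _).trans ?_
  rw [← pow_mul, toddBits]
  exact pow_le_pow_right₀ (by norm_num)
    (Nat.mul_le_mul_left _ (Nat.mul_le_mul (hj.trans hsS) hsS))

theorem abs_le_of_eq_scaledTodd {s m : ℕ} {β : ℕ → ℤ} (hsS : s ≤ S)
    (hβ : ∀ i, |β i| ≤ 2 ^ dotBits S) (hm : m ≤ s) {z : ℤ}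
    (hz : (z : ℚ) = scaledTodd (s + 1).factorial β s m) : |z| ≤ 2 ^ toddBits S := by
  have h := abs_scaledTodd_le (A := 2 ^ powBits S + 1) (s := s)
    (by simp) s (fun i _ => abs_table_le hsS hβ i) m hm
  rw [← hz] at h
  exact_mod_cast h.trans (pow_le_two_pow_toddBits hsS le_rfl)

/-- A bound for the intermediate results of the division in place. -/
theorem intSize_division_le {s j : ℕ} {β : ℕ → ℤ} (hsS : s ≤ S) (hjs : j < s)
    (hβ : ∀ i, |β i| ≤ 2 ^ dotBits S) (hb : toddBits S + 2 ≤ b) {m K : ℕ} (hm : m ≤ s)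
    (hK : K ≤ m) {z : ℤ} (hz : (z : ℚ) = scaledTodd (s + 1).factorial β j m -
      ∑ k ∈ Finset.range K, ((((s + 1).factorial : ℕ) * β j) ^ (k + 1) / (k + 2).factorial : ℚ) *
        scaledTodd (s + 1).factorial β (j + 1) (m - (k + 1))) : intSize z ≤ b := by
  have h := abs_scaledTodd_sub_sum_le (A := 2 ^ powBits S + 1) (s := s)
    (by simp) j (fun i _ => abs_table_le hsS hβ i) m hm K hK
  rw [← hz] at h
  exact intSize_le_of_abs_le
    (by exact_mod_cast h.trans (pow_le_two_pow_toddBits hsS (by omega))) hb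

theorem wp_toddStepProg {n s p j : ℕ} {x Q G : ℤ} {β : ℕ → ℤ} (hb : bitBound S ≤ b)
    (hf : ∀ y, |σ 0 y| ≤ 2 ^ S) (hx : |x| ≤ 2 ^ xiBits S) (hpow : ∀ k < n, σ 1 k = x ^ k)
    (hn : σ 4 0 = n) (hp : σ 6 0 = p) (hs : σ 13 0 = s) (hF : σ 14 0 = ((s + 1).factorial : ℤ))
    (hj : σ 11 0 = j) (hjs : j < s)
    (hC : ∀ m ≤ s, (σ 2 m : ℚ) = scaledTodd (s + 1).factorial β j m)
    (hQ : σ 17 0 = Q) (hG : σ 23 0 = G)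
    (hQb : intSize (Q * -β j) ≤ b) (hGb : intSize (G * ((s + 1).factorial : ℤ)) ≤ b)
    (hnS : n ≤ S) (hsS : s ≤ S) (hpS : p + 3 + n + s * n ≤ S)
    (hβ : ∀ j : ℕ, β j = dotAt x (σ 0) n (p + 3 + n + j * n)) :
    WP (S + 1) b toddStepProg (fun τ =>
      (∀ m ≤ s, (τ 2 m : ℚ) = scaledTodd (s + 1).factorial β (j + 1) m) ∧
      τ 17 0 = Q * -β j ∧ τ 23 0 = G * ((s + 1).factorial : ℤ)) σ := by
  unfold bitBound at hb
  have hL : S + 1 + 1 ≤ b := by omega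
  have hβS : ∀ j, |β j| ≤ 2 ^ dotBits S := fun j => by
    rw [hβ]; exact abs_dotAt_le hx hf hnS _
  have hjn : j * n ≤ s * n := Nat.mul_le_mul_right _ hjs.le
  have hdot := wp_dotProg (L := S + 1) (b := b) (σ := σ) (n := n) (x := x)
    (q := ((p + 3 + n + j * n : ℕ) : ℤ))
    (e := .add (.add (.add (var 6) (.const 3)) (var 4)) (.mul (var 11) (var 4)))
    (by simp [Expr.eval, hp, hn, hj]) hn (by omega) hL hpow
    ((intSize_natCast_le _).trans (by omega))
    (fun m hm => intSize_le_of_abs_le (abs_dotAt_le hx hf (hm.trans hnS) _) (by omega))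
  refine wp_seq (wp_mono hdot fun ρ hfρ h8 => ?_)
  have h8' : ρ 8 0 = β j := by
    rw [h8, hβ, dotAt]
    push_cast
    rfl
  have g13 : ρ 13 = σ 13 := hfρ 13 (by decide)
  have g14 : ρ 14 = σ 14 := hfρ 14 (by decide)
  have v17 : (Expr.mul (var 17) (.sub (.const 0) (var 8))).eval ρ = Q * -β j := by
    simp [Expr.eval, hfρ 17 (by decide), hQ, h8']
  refine wp_seq (wp_setVar (by rwa [v17]) ?_)
  rw [v17]
  have v23 : (Expr.mul (var 23) (var 14)).eval (write ρ 17 0 (Q * -β j)) =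
      G * ((s + 1).factorial : ℤ) := by
    simp [Expr.eval, write_of_ne, hfρ 23 (by decide), hG, g14, hF]
  refine wp_seq (wp_setVar (by rwa [v23]) ?_)
  rw [v23]
  have fr : ∀ y, y ≠ 17 → y ≠ 23 →
      write (write ρ 17 0 (Q * -β j)) 23 0 (G * ((s + 1).factorial : ℤ)) y = ρ y :=
    fun y hy hy' => by rw [write_of_ne _ _ _ hy', write_of_ne _ _ _ hy]
  have s17 : write (write ρ 17 0 (Q * -β j)) 23 0 (G * ((s + 1).factorial : ℤ)) 17 0 =
      Q * -β j := by simp [write_apply]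
  have s23 : write (write ρ 17 0 (Q * -β j)) 23 0 (G * ((s + 1).factorial : ℤ)) 23 0 =
      G * ((s + 1).factorial : ℤ) := by simp [write_apply]
  generalize write (write ρ 17 0 (Q * -β j)) 23 0 (G * ((s + 1).factorial : ℤ)) = ρ'
    at fr s17 s23 ⊢
  have htab := wp_tableProg (L := S + 1) (b := b) (σ := ρ') (s := s)
    (F := (s + 1).factorial) (t := β j)
    (by rw [fr 13 (by decide) (by decide), g13, hs])
    (by rw [fr 14 (by decide) (by decide), g14, hF])
    (by rw [fr 8 (by decide) (by decide), h8']) rfl (by omega) hL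
    (fun k hk => intSize_le_of_abs_le (abs_pow_le_two_pow (K := S + 1)
      (abs_mul_le_two_pow (abs_factorial_le (S := S) (by omega)) (hβS j)) (by omega))
      (by unfold powBits at hb; omega))
    (fun k hk => intSize_le_of_abs_le (abs_factorial_le (S := S) (by omega)) (by omega))
  refine wp_seq (wp_mono htab fun υ hfυ h3 => ?_)
  have hdiv := wp_divideProg (L := S + 1) (b := b) (σ := υ) (s := s)
    (c := scaledTodd (s + 1).factorial β (j + 1)) (d := scaledTodd (s + 1).factorial β j)
    (e := fun k => (((s + 1).factorial : ℕ) * β j) ^ (k + 1) / (k + 2).factorial)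
    (by rw [hfυ 13 (by decide), fr 13 (by decide) (by decide), g13, hs]) (by omega) hL
    (fun k hk => by
      have := h3 (k + 1) (by omega)
      push_cast at this ⊢
      exact this)
    (fun m hm => by
      rw [hfυ 2 (by decide), fr 2 (by decide) (by decide), hfρ 2 (by decide)]; exact hC m hm)
    (scaledTodd_succ _ β j)
    (fun m hm K hK z hz => intSize_division_le hsS hjs hβS (by omega) hm hK hz)
  refine wp_mono hdiv fun ω hfω h => ⟨h, ?_, ?_⟩
  · rw [hfω 17 (by decide), hfυ 17 (by decide), s17]
  · rw [hfω 23 (by decide), hfυ 23 (by decide), s23]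

/-- After pass number `j`, the memory holds the scaled Todd polynomials in `j` arguments. -/
theorem wp_toddProg {n s p : ℕ} {x : ℤ} {β : ℕ → ℤ} (hb : bitBound S ≤ b)
    (hf : ∀ y, |σ 0 y| ≤ 2 ^ S)
    (hx : |x| ≤ 2 ^ xiBits S) (hpow : ∀ k < n, σ 1 k = x ^ k)
    (hn : σ 4 0 = n) (hp : σ 6 0 = p) (hs : σ 13 0 = s) (hF : σ 14 0 = ((s + 1).factorial : ℤ))
    (hC : ∀ m ≤ s, σ 2 m = if m = 0 then 1 else 0)
    (hnS : n ≤ S) (hsS : s ≤ S) (hpS : p + 3 + n + s * n ≤ S)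
    (hβ : ∀ j : ℕ, β j = dotAt x (σ 0) n (p + 3 + n + j * n)) :
    WP (S + 1) b toddProg (fun τ =>
      (∀ m ≤ s, (τ 2 m : ℚ) = scaledTodd (s + 1).factorial β s m) ∧
      τ 17 0 = ∏ j ∈ Finset.range s, -β j ∧ τ 23 0 = ((s + 1).factorial : ℤ) ^ s) σ := by
  have hb' := hb
  unfold bitBound at hb'
  have hb1 : intSize 1 ≤ b := (intSize_natCast_le 1).trans (by omega)
  have hL : S + 1 + 1 ≤ b := by omega
  have hβS : ∀ j, |β j| ≤ 2 ^ dotBits S := fun j => by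
    rw [hβ]; exact abs_dotAt_le hx hf hnS _
  refine wp_seq (wp_setVar hb1 (wp_seq (wp_setVar hb1 ?_)))
  have fr : ∀ y, y ≠ 17 → y ≠ 23 → write (write σ 17 0 1) 23 0 1 y = σ y :=
    fun y hy hy' => by rw [write_of_ne _ _ _ hy', write_of_ne _ _ _ hy]
  refine wp_forLoop (n := s) (fun j τ =>
    (∀ m ≤ s, (τ 2 m : ℚ) = scaledTodd (s + 1).factorial β j m) ∧
      τ 17 0 = ∏ j' ∈ Finset.range j, -β j' ∧ τ 23 0 = ((s + 1).factorial : ℤ) ^ j)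
    (by omega) hL (by decide) ?_ ?_ ?_ ?_
  · intro τ hfr
    simp [Expr.eval, hfr 13 (by decide) (by decide), write_of_ne, hs]
  · refine ⟨fun m hm => ?_, ?_, ?_⟩
    · rw [scaledTodd_zero]
      simp only [write_apply, Nat.reduceEqDiff, false_and, if_false]
      rw [hC m hm]
      split_ifs <;> simp
    · simp [write_apply, Expr.eval]
    · simp [write_apply, Expr.eval]
  · rintro j hj τ hfr hj0 ⟨h2, h17, h23⟩
    have h0 : τ 0 = σ 0 := (hfr 0 (by decide) (by decide)).trans (fr 0 (by decide) (by decide))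
    have h1 : τ 1 = σ 1 := (hfr 1 (by decide) (by decide)).trans (fr 1 (by decide) (by decide))
    have h4 : τ 4 = σ 4 := (hfr 4 (by decide) (by decide)).trans (fr 4 (by decide) (by decide))
    have h6 : τ 6 = σ 6 := (hfr 6 (by decide) (by decide)).trans (fr 6 (by decide) (by decide))
    have h13 : τ 13 = σ 13 := (hfr 13 (by decide) (by decide)).trans (fr 13 (by decide) (by decide))
    have h14 : τ 14 = σ 14 := (hfr 14 (by decide) (by decide)).trans (fr 14 (by decide) (by decide))
    have hQ : (∏ j' ∈ Finset.range j, -β j') * -β j = ∏ j' ∈ Finset.range (j + 1), -β j' :=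
      (Finset.prod_range_succ _ _).symm
    have hstep := wp_toddStepProg (σ := τ) hb (by rwa [h0]) hx (by rwa [h1]) (by rwa [h4])
      (by rwa [h6]) (by rwa [h13]) (by rwa [h14]) hj0 hj h2 h17 h23
      (by
        rw [hQ]
        refine intSize_le_of_abs_le (abs_prod_le_two_pow (d := dotBits S) (M := S + 1)
          (fun i _ => by rw [abs_neg]; exact hβS i) (by omega)) ?_
        omega)
      (by
        rw [← pow_succ]
        refine intSize_le_of_abs_le (abs_pow_le_two_pow (d := facBits S) (K := S + 1)
          (abs_factorial_le (by omega)) (by omega)) ?_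
        omega) hnS hsS hpS (by rwa [h0])
    refine wp_mono hstep fun ρ _ h => ⟨?_, ?_, ?_⟩
    · simpa [write_apply] using h.1
    · rw [write_of_ne _ _ _ (by decide), h.2.1, hQ]
    · rw [write_of_ne _ _ _ (by decide), h.2.2, pow_succ]
  · exact fun τ _ h => h

end RAM

namespace RAM

/-! ### Output of the weights and summation -/

/-- One pass of the output loop: the weight number `l` is written as a fraction to array `1`, and
its contribution is added to the fraction in the variables `19` and `20`. -/
def outputStepProg : Prog :=
  .seq (setVar 25 (.mul (.mul (.read 2 (.sub (var 13) (var 12))) (var 24)) (var 17)))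
  (.seq (setVar 26 (.mul (.mul (var 23) (var 16)) (.mul (var 17) (var 17))))
  (.seq (.assign 1 (var 21) (var 25))
  (.seq (.assign 1 (.add (var 21) (.const 1)) (var 26))
  (.seq (setVar 21 (.add (var 21) (.const 2)))
  (.seq (setVar 19 (.add (.mul (var 19) (.mul (.read 0 (.add (var 6) (.const 1))) (var 26)))
    (.mul (var 20) (.mul (.mul (.read 0 (var 6)) (var 25)) (var 15)))))
  (.seq (setVar 20 (.mul (var 20) (.mul (.read 0 (.add (var 6) (.const 1))) (var 26))))
  (.seq (setVar 15 (.mul (var 15) (var 18)))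
  (.seq (setVar 24 (.mul (var 24) (var 14)))
  (setVar 16 (.mul (var 16) (.add (var 12) (.const 1))))))))))))

/-- The output of all weights of one summand. -/
def outputProg : Prog :=
  .seq (setVar 15 (.const 1)) (.seq (setVar 24 (.const 1)) (.seq (setVar 16 (.const 1))
    (forLoop 12 (.add (var 13) (.const 1)) outputStepProg)))

variable {b S : ℕ} {σ : Store}

theorem wp_outputStepProg {L : ℕ} {p o l s c g Q G f w α F u v : ℤ}
    (h6 : σ 6 0 = p) (h21 : σ 21 0 = o) (h12 : σ 12 0 = l) (h13 : σ 13 0 = s)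
    (h2 : σ 2 (s - l) = c) (h24 : σ 24 0 = g) (h17 : σ 17 0 = Q) (h23 : σ 23 0 = G)
    (h16 : σ 16 0 = f) (h15 : σ 15 0 = w) (h18 : σ 18 0 = α) (h14 : σ 14 0 = F)
    (h19 : σ 19 0 = u) (h20 : σ 20 0 = v)
    (bnum : intSize (c * g * Q) ≤ b) (bden : intSize (G * f * (Q * Q)) ≤ b)
    (bo : intSize (o + 2) ≤ b)
    (bu : intSize (u * (σ 0 (p + 1) * (G * f * (Q * Q))) + v * (σ 0 p * (c * g * Q) * w)) ≤ b)
    (bv : intSize (v * (σ 0 (p + 1) * (G * f * (Q * Q)))) ≤ b)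
    (bw : intSize (w * α) ≤ b) (bg : intSize (g * F) ≤ b) (bf : intSize (f * (l + 1)) ≤ b) :
    WP L b outputStepProg (fun τ => τ 1 o = c * g * Q ∧ τ 1 (o + 1) = G * f * (Q * Q) ∧
      (∀ y, y ≠ o → y ≠ o + 1 → τ 1 y = σ 1 y) ∧ τ 21 0 = o + 2 ∧
      τ 19 0 = u * (σ 0 (p + 1) * (G * f * (Q * Q))) + v * (σ 0 p * (c * g * Q) * w) ∧
      τ 20 0 = v * (σ 0 (p + 1) * (G * f * (Q * Q))) ∧
      τ 15 0 = w * α ∧ τ 24 0 = g * F ∧ τ 16 0 = f * (l + 1)) σ := by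
  refine wp_seq (wp_setVar ?_ (wp_seq (wp_setVar ?_ (wp_seq (wp_assign ?_ (wp_seq (wp_assign ?_
    (wp_seq (wp_setVar ?_ (wp_seq (wp_setVar ?_ (wp_seq (wp_setVar ?_ (wp_seq (wp_setVar ?_
    (wp_seq (wp_setVar ?_ (wp_setVar ?_ ?_)))))))))))))))))) <;>
  simp only [Expr.eval, write_apply, Nat.reduceEqDiff, false_and, if_false, true_and, if_true,
    and_self, h6, h21, h12, h13, h2, h24, h17, h23, h16, h15, h18, h14, h19, h20]
  all_goals first
    | assumption
    | skip
  exact ⟨by simp, fun y hy hy' => by simp [hy, hy'], trivial⟩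

/-- A bound for the numerator of a sum of two fractions. -/
theorem abs_mul_add_mul_le {u v y z : ℤ} {d e : ℕ} (hu : |u| ≤ 2 ^ d) (hv : |v| ≤ 2 ^ d)
    (hy : |y| ≤ 2 ^ e) (hz : |z| ≤ 2 ^ e) : |u * y + v * z| ≤ 2 ^ (d + (e + 1)) := by
  have h1 := abs_mul_le_two_pow hu hy
  have h2 := abs_mul_le_two_pow hv hz
  have h3 := abs_add_le (u * y) (v * z)
  rw [← add_assoc, pow_succ]
  linarith

/-- The accumulated fraction grows by `termBits S` bits with every weight; `a` is the number of bits it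
has at the beginning. -/
theorem wp_outputProg {p s o a : ℕ} {c : ℕ → ℤ} {Q G α F u v : ℤ} (hb : bitBound S ≤ b)
    (hf : ∀ y, |σ 0 y| ≤ 2 ^ S) (hden : 0 < σ 0 (p + 1))
    (h6 : σ 6 0 = p) (h21 : σ 21 0 = o) (h13 : σ 13 0 = s)
    (h2 : ∀ m ≤ s, σ 2 m = c m) (h17 : σ 17 0 = Q) (h23 : σ 23 0 = G)
    (h18 : σ 18 0 = α) (h14 : σ 14 0 = F) (h19 : σ 19 0 = u) (h20 : σ 20 0 = v)
    (hsS : s ≤ S) (hc : ∀ m ≤ s, |c m| ≤ 2 ^ toddBits S) (hFb : |F| ≤ 2 ^ facBits S)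
    (hQb : |Q| ≤ 2 ^ (dotBits S * S)) (hGb : |G| ≤ 2 ^ (facBits S * (S + 1)))
    (hαb : |α| ≤ 2 ^ dotBits S) (hG : 0 < G) (hQ : Q ≠ 0) (hv : 0 < v)
    (hu' : |u| ≤ 2 ^ a) (hv' : |v| ≤ 2 ^ a) (ha : a + termBits S * (s + 1) + 2 ≤ b)
    (ho : o + 2 * (s + 1) + 1 ≤ b) :
    WP (S + 1) b outputProg (fun τ =>
      (∀ l ≤ s, τ 1 (o + 2 * l) = c (s - l) * F ^ l * Q ∧
        τ 1 (o + 2 * l + 1) = G * (l.factorial : ℤ) * (Q * Q)) ∧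
      (∀ y < (o : ℤ), τ 1 y = σ 1 y) ∧ τ 21 0 = ((o + 2 * (s + 1) : ℕ) : ℤ) ∧
      0 < τ 20 0 ∧ |τ 19 0| ≤ 2 ^ (a + termBits S * (s + 1)) ∧
      |τ 20 0| ≤ 2 ^ (a + termBits S * (s + 1)) ∧
      (τ 19 0 / τ 20 0 : ℚ) = u / v + ∑ l ∈ Finset.range (s + 1),
        (σ 0 p / σ 0 (p + 1) : ℚ) * ((c (s - l) * F ^ l * Q : ℤ) /
          (G * (l.factorial : ℤ) * (Q * Q) : ℤ) * α ^ l)) σ := by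
  have hb' := hb
  unfold bitBound at hb'
  have hb1 : intSize 1 ≤ b := (intSize_natCast_le 1).trans (by omega)
  have hL : S + 1 + 1 ≤ b := by omega
  refine wp_seq (wp_setVar hb1 (wp_seq (wp_setVar hb1 (wp_seq (wp_setVar hb1 ?_)))))
  have fr : ∀ y, y ≠ 15 → y ≠ 24 → y ≠ 16 →
      write (write (write σ 15 0 1) 24 0 1) 16 0 1 y = σ y :=
    fun y hy hy' hy'' => by rw [write_of_ne _ _ _ hy'', write_of_ne _ _ _ hy', write_of_ne _ _ _ hy]
  refine wp_forLoop (n := s + 1) (fun l τ =>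
    (∀ i < l, τ 1 (o + 2 * i) = c (s - i) * F ^ i * Q ∧
        τ 1 (o + 2 * i + 1) = G * (i.factorial : ℤ) * (Q * Q)) ∧
      (∀ y < (o : ℤ), τ 1 y = σ 1 y) ∧ τ 21 0 = ((o + 2 * l : ℕ) : ℤ) ∧
      τ 15 0 = α ^ l ∧ τ 24 0 = F ^ l ∧ τ 16 0 = (l.factorial : ℤ) ∧
      0 < τ 20 0 ∧ |τ 19 0| ≤ 2 ^ (a + termBits S * l) ∧
      |τ 20 0| ≤ 2 ^ (a + termBits S * l) ∧
      (τ 19 0 / τ 20 0 : ℚ) = u / v + ∑ l ∈ Finset.range l,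
        (σ 0 p / σ 0 (p + 1) : ℚ) * ((c (s - l) * F ^ l * Q : ℤ) /
          (G * (l.factorial : ℤ) * (Q * Q) : ℤ) * α ^ l)) (by omega) hL (by decide) ?_ ?_ ?_ ?_
  · intro τ hfr
    simp [Expr.eval, hfr 13 (by decide) (by decide), write_of_ne, h13]
  · have fr1 := fr 1 (by decide) (by decide) (by decide)
    have fr19 := fr 19 (by decide) (by decide) (by decide)
    have fr20 := fr 20 (by decide) (by decide) (by decide)
    have fr21 := fr 21 (by decide) (by decide) (by decide)
    refine ⟨fun i hi => absurd hi (by omega), fun y _ => ?_, ?_, ?_, ?_, ?_, ?_, ?_, ?_, ?_⟩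
    · rw [write_of_ne _ _ _ (by decide)]; exact congrFun fr1 y
    · rw [write_of_ne _ _ _ (by decide)]; exact (congrFun fr21 0).trans (by simpa using h21)
    · simp [write_apply, Expr.eval]
    · simp [write_apply, Expr.eval]
    · simp [write_apply, Expr.eval]
    · simpa [write_apply, h20] using hv
    · simpa [write_apply, h19] using hu'
    · simpa [write_apply, h20] using hv'
    · simp [write_apply, h19, h20]
  · rintro l hl τ hfr hl0 ⟨i1, i2, i21, i15, i24, i16, i20, iu, iv, isum⟩
    have hls : l ≤ s := by omega
    have t0 : τ 0 = σ 0 := (hfr 0 (by decide) (by decide)).trans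
      (fr 0 (by decide) (by decide) (by decide))
    have t6 : τ 6 = σ 6 := (hfr 6 (by decide) (by decide)).trans
      (fr 6 (by decide) (by decide) (by decide))
    have t2 : τ 2 = σ 2 := (hfr 2 (by decide) (by decide)).trans
      (fr 2 (by decide) (by decide) (by decide))
    have t13 : τ 13 = σ 13 := (hfr 13 (by decide) (by decide)).trans
      (fr 13 (by decide) (by decide) (by decide))
    have t14 : τ 14 = σ 14 := (hfr 14 (by decide) (by decide)).trans
      (fr 14 (by decide) (by decide) (by decide))
    have t17 : τ 17 = σ 17 := (hfr 17 (by decide) (by decide)).trans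
      (fr 17 (by decide) (by decide) (by decide))
    have t18 : τ 18 = σ 18 := (hfr 18 (by decide) (by decide)).trans
      (fr 18 (by decide) (by decide) (by decide))
    have t23 : τ 23 = σ 23 := (hfr 23 (by decide) (by decide)).trans
      (fr 23 (by decide) (by decide) (by decide))
    have num_le : |c (s - l) * F ^ l * Q| ≤ 2 ^ numBits S :=
      abs_mul_le_two_pow (abs_mul_le_two_pow (hc _ (by omega))
        (abs_pow_le_two_pow hFb (by omega))) hQb
    have den_le : |G * (l.factorial : ℤ) * (Q * Q)| ≤ 2 ^ denBits S :=
      abs_mul_le_two_pow (abs_mul_le_two_pow hGb (abs_factorial_le (by omega)))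
        (abs_mul_le_two_pow hQb hQb)
    have den_pos : 0 < G * (l.factorial : ℤ) * (Q * Q) :=
      mul_pos (mul_pos hG (by exact_mod_cast l.factorial_pos)) (mul_self_pos.2 hQ)
    have mono : ∀ {z : ℤ} {d e : ℕ}, d ≤ e → |z| ≤ 2 ^ d → |z| ≤ 2 ^ e := fun hde hz =>
      hz.trans (pow_le_pow_right₀ (by norm_num) hde)
    obtain ⟨T, hT, hT1, hT2⟩ : ∃ T, termBits S = T + 1 ∧ S + denBits S ≤ T ∧
        S + numBits S + dotBits S * (S + 1) ≤ T :=
      ⟨_, rfl, by omega, by omega⟩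
    have fac1 : |σ 0 (p + 1) * (G * (l.factorial : ℤ) * (Q * Q))| ≤ 2 ^ T :=
      mono hT1 (abs_mul_le_two_pow (hf _) den_le)
    have fac2 : |σ 0 p * (c (s - l) * F ^ l * Q) * α ^ l| ≤ 2 ^ T :=
      mono hT2 (abs_mul_le_two_pow (abs_mul_le_two_pow (hf _) num_le)
        (abs_pow_le_two_pow hαb (by omega)))
    have hexp : a + termBits S * (l + 1) = a + termBits S * l + (T + 1) := by rw [hT]; ring
    have hexp' : a + termBits S * (l + 1) ≤ a + termBits S * (s + 1) :=
      Nat.add_le_add_left (Nat.mul_le_mul_left _ (by omega)) _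
    have nu : |τ 19 0 * (σ 0 (p + 1) * (G * (l.factorial : ℤ) * (Q * Q))) +
        τ 20 0 * (σ 0 p * (c (s - l) * F ^ l * Q) * α ^ l)| ≤ 2 ^ (a + termBits S * (l + 1)) := by
      rw [hexp]; exact abs_mul_add_mul_le iu iv fac1 fac2
    have nv : |τ 20 0 * (σ 0 (p + 1) * (G * (l.factorial : ℤ) * (Q * Q)))| ≤
        2 ^ (a + termBits S * (l + 1)) := by
      rw [hexp]; exact mono (by omega) (abs_mul_le_two_pow iv fac1)
    have hstep := wp_outputStepProg (L := S + 1) (b := b) (σ := τ) (p := p) (l := l) (s := s)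
      (c := c (s - l)) (g := F ^ l) (f := (l.factorial : ℤ)) (w := α ^ l) (α := α) (F := F)
      (Q := Q) (G := G) (o := ((o + 2 * l : ℕ) : ℤ)) (u := τ 19 0) (v := τ 20 0)
      (by rw [t6, h6]) i21 hl0 (by rw [t13, h13])
      (by rw [t2, ← Nat.cast_sub hls]; exact h2 _ (by omega)) i24 (by rw [t17, h17])
      (by rw [t23, h23]) i16 i15 (by rw [t18, h18]) (by rw [t14, h14]) rfl rfl
      (intSize_le_of_abs_le num_le (by omega)) (intSize_le_of_abs_le den_le (by omega))
      ((intSize_natCast_le (o + 2 * l + 2)).trans (by omega))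
      (by rw [t0]; exact intSize_le_of_abs_le nu (by omega))
      (by rw [t0]; exact intSize_le_of_abs_le nv (by omega))
      (by
        rw [← pow_succ]
        exact intSize_le_of_abs_le (abs_pow_le_two_pow hαb (K := S + 1) (by omega)) (by omega))
      (by
        rw [← pow_succ]
        exact intSize_le_of_abs_le (abs_pow_le_two_pow hFb (K := S + 1) (by omega)) (by omega))
      (by
        have h := abs_factorial_le (S := S) (k := l + 1) (by omega)
        rw [Nat.factorial_succ, mul_comm] at h
        push_cast at h
        exact intSize_le_of_abs_le h (by omega))
    refine wp_mono hstep fun ρ _ ⟨k1, k2, k3, k4, k5, k6, k7, k8, k9⟩ => ?_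
    rw [t0] at k5 k6
    have w1 : ∀ y, y ≠ 12 → write ρ 12 0 ((l : ℤ) + 1) y = ρ y := fun y hy => write_of_ne _ _ _ hy
    simp only [w1 1 (by decide), w1 21 (by decide), w1 15 (by decide), w1 24 (by decide),
      w1 16 (by decide), w1 20 (by decide), w1 19 (by decide)]
    push_cast at k1 k2 k3 k4
    refine ⟨fun i hi => ?_, fun y hy => ?_, ?_, ?_, ?_, ?_, ?_, ?_, ?_, ?_⟩
    · rcases Nat.lt_succ_iff_lt_or_eq.1 hi with h | rfl
      · rw [k3 _ (by omega) (by omega), k3 _ (by omega) (by omega)]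
        exact i1 i h
      · exact ⟨k1, k2⟩
    · rw [k3 y (by omega) (by omega), i2 y hy]
    · rw [k4]; push_cast; ring
    · rw [k7, pow_succ]
    · rw [k8, pow_succ]
    · rw [k9, Nat.factorial_succ]; push_cast; ring
    · rw [k6]; exact mul_pos i20 (mul_pos hden den_pos)
    · rw [k5]; exact nu
    · rw [k6]; exact nv
    · rw [Finset.sum_range_succ, ← add_assoc, ← isum, k5, k6]
      have e1 : (τ 20 0 : ℚ) ≠ 0 := by exact_mod_cast i20.ne'
      have e2 : (σ 0 (p + 1) : ℚ) ≠ 0 := by exact_mod_cast hden.ne'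
      have e3 : ((G * (l.factorial : ℤ) * (Q * Q) : ℤ) : ℚ) ≠ 0 := by exact_mod_cast den_pos.ne'
      generalize G * (l.factorial : ℤ) * (Q * Q) = d at e3 ⊢
      push_cast
      field_simp
  · exact fun τ _ h => ⟨fun l hl => h.1 l (by omega), h.2.1, h.2.2.1, h.2.2.2.2.2.2⟩

end RAM

namespace RAM

/-! ### The main loop -/

/-- The weight of a summand with `s` denominator factors, expressed by the pairings `β_j`. -/
noncomputable def toddWeight (s : ℕ) (β : ℕ → ℤ) (l : ℕ) : ℚ :=
  todd (s - l) (fun j : Fin s => (-(β j) : ℚ)) /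
    (l.factorial * ∏ j ∈ Finset.range s, (-(β j) : ℚ))

/-- The treatment of one summand. -/
def blockProg : Prog :=
  .seq (dotProg (.add (var 6) (.const 3))) (.seq (setVar 18 (var 8)) (.seq initSeriesProg
    (.seq toddProg (.seq outputProg (setVar 6 (.add (.add (.add (var 6) (.const 3)) (var 4))
      (.mul (var 13) (var 4))))))))

variable {b S : ℕ} {σ : Store}

/-- The effect of the treatment of one summand, whose data begin at the address `p` and whose weights
are written from the address `o` on. -/
theorem wp_blockProg {n p s o a : ℕ} {x α u v : ℤ} {β : ℕ → ℤ} (hb : bitBound S ≤ b)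
    (hf : ∀ y, |σ 0 y| ≤ 2 ^ S) (hx : |x| ≤ 2 ^ xiBits S) (hpow : ∀ k < n, σ 1 k = x ^ k)
    (hn : σ 4 0 = n) (hp : σ 6 0 = p) (hs : σ 0 (p + 2) = s) (hden : 0 < σ 0 (p + 1))
    (h21 : σ 21 0 = o) (h19 : σ 19 0 = u) (h20 : σ 20 0 = v)
    (hnS : n ≤ S) (hsS : s ≤ S) (hpS : p + 3 + n + s * n ≤ S)
    (hα : α = dotAt x (σ 0) n (p + 3))
    (hβ : ∀ j : ℕ, β j = dotAt x (σ 0) n (p + 3 + n + j * n)) (hβ0 : ∀ j < s, β j ≠ 0)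
    (hv : 0 < v) (hu' : |u| ≤ 2 ^ a) (hv' : |v| ≤ 2 ^ a)
    (ha : a + termBits S * (s + 1) + 2 ≤ b) (ho : o + 2 * (s + 1) + 1 ≤ b) :
    WP (S + 1) b blockProg (fun τ => τ 6 0 = ((p + 3 + n + s * n : ℕ) : ℤ) ∧
      (∀ l ≤ s, 0 < τ 1 (o + 2 * l + 1) ∧
        (τ 1 (o + 2 * l) / τ 1 (o + 2 * l + 1) : ℚ) = toddWeight s β l) ∧
      (∀ y < (o : ℤ), τ 1 y = σ 1 y) ∧ τ 21 0 = ((o + 2 * (s + 1) : ℕ) : ℤ) ∧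
      0 < τ 20 0 ∧ |τ 19 0| ≤ 2 ^ (a + termBits S * (s + 1)) ∧
      |τ 20 0| ≤ 2 ^ (a + termBits S * (s + 1)) ∧
      (τ 19 0 / τ 20 0 : ℚ) = u / v + (σ 0 p / σ 0 (p + 1) : ℚ) *
        ∑ l ∈ Finset.range (s + 1), toddWeight s β l * (α : ℚ) ^ l) σ := by
  have hb' := hb
  unfold bitBound at hb'
  have hL : S + 1 + 1 ≤ b := by omega
  have hαb : |α| ≤ 2 ^ dotBits S := by rw [hα]; exact abs_dotAt_le hx hf hnS _
  have hβb : ∀ j, |β j| ≤ 2 ^ dotBits S := fun j => by rw [hβ]; exact abs_dotAt_le hx hf hnS _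
  have hdot := wp_dotProg (L := S + 1) (b := b) (σ := σ) (n := n) (x := x)
    (q := ((p + 3 : ℕ) : ℤ)) (e := .add (var 6) (.const 3))
    (by simp [Expr.eval, hp]) hn (by omega) hL hpow
    ((intSize_natCast_le _).trans (by omega))
    (fun m hm => intSize_le_of_abs_le (abs_dotAt_le hx hf (hm.trans hnS) _) (by omega))
  refine wp_seq (wp_mono hdot fun ρ hfρ h8 => ?_)
  have h8' : (var 8).eval ρ = α := by
    simp only [Expr.eval, h8, hα, dotAt]
    push_cast
    rfl
  refine wp_seq (wp_setVar (by rw [h8']; exact intSize_le_of_abs_le hαb (by omega)) ?_)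
  rw [h8']
  have fr1 : ∀ y, y ≠ 18 → y ≠ 22 → y ≠ 8 → y ≠ 9 → write ρ 18 0 α y = σ y :=
    fun y h1 h2 h3 h4 => by
      rw [write_of_ne _ _ _ h1, hfρ y (by simp [dotProg, Prog.mods, mods_forLoop]; tauto)]
  have e18 : write ρ 18 0 α 18 0 = α := by simp [write_apply]
  generalize write ρ 18 0 α = ρ₁ at fr1 e18 ⊢
  have g0 : ρ₁ 0 = σ 0 := fr1 0 (by decide) (by decide) (by decide) (by decide)
  have g1 : ρ₁ 1 = σ 1 := fr1 1 (by decide) (by decide) (by decide) (by decide)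
  have g4 : ρ₁ 4 = σ 4 := fr1 4 (by decide) (by decide) (by decide) (by decide)
  have g6 : ρ₁ 6 = σ 6 := fr1 6 (by decide) (by decide) (by decide) (by decide)
  have g19 : ρ₁ 19 = σ 19 := fr1 19 (by decide) (by decide) (by decide) (by decide)
  have g20 : ρ₁ 20 = σ 20 := fr1 20 (by decide) (by decide) (by decide) (by decide)
  have g21 : ρ₁ 21 = σ 21 := fr1 21 (by decide) (by decide) (by decide) (by decide)
  have hini := wp_initSeriesProg (L := S + 1) (b := b) (σ := ρ₁) (s := s)
    (by rw [g0, g6, hp, hs]) (by omega) hL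
    (fun k hk => intSize_le_of_abs_le (abs_factorial_le (S := S) (by omega)) (by omega))
  refine wp_seq (wp_mono hini fun ρ₂ hf₂ ⟨k13, k14, k2⟩ => ?_)
  have htodd := wp_toddProg (σ := ρ₂) (n := n) (s := s) (p := p) (x := x) (β := β) hb
    (by rw [hf₂ 0 (by decide), g0]; exact hf) hx (by rw [hf₂ 1 (by decide), g1]; exact hpow)
    (by rw [hf₂ 4 (by decide), g4, hn]) (by rw [hf₂ 6 (by decide), g6, hp]) k13 k14 k2 hnS hsS hpS
    (by rw [hf₂ 0 (by decide), g0]; exact hβ)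
  refine wp_seq (wp_mono htodd fun ρ₃ hf₃ ⟨m2, m17, m23⟩ => ?_)
  have r0 : ρ₃ 0 = σ 0 := (hf₃ 0 (by decide)).trans ((hf₂ 0 (by decide)).trans g0)
  have r1 : ρ₃ 1 = σ 1 := (hf₃ 1 (by decide)).trans ((hf₂ 1 (by decide)).trans g1)
  have r4 : ρ₃ 4 = σ 4 := (hf₃ 4 (by decide)).trans ((hf₂ 4 (by decide)).trans g4)
  have r6 : ρ₃ 6 = σ 6 := (hf₃ 6 (by decide)).trans ((hf₂ 6 (by decide)).trans g6)
  have r19 : ρ₃ 19 = σ 19 := (hf₃ 19 (by decide)).trans ((hf₂ 19 (by decide)).trans g19)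
  have r20 : ρ₃ 20 = σ 20 := (hf₃ 20 (by decide)).trans ((hf₂ 20 (by decide)).trans g20)
  have r21 : ρ₃ 21 = σ 21 := (hf₃ 21 (by decide)).trans ((hf₂ 21 (by decide)).trans g21)
  have r13 : ρ₃ 13 0 = s := by rw [hf₃ 13 (by decide), k13]
  have hQ0 : ∏ j ∈ Finset.range s, -β j ≠ 0 :=
    Finset.prod_ne_zero_iff.2 fun j hj => neg_ne_zero.2 (hβ0 j (Finset.mem_range.1 hj))
  have hFpos : (0 : ℤ) < (s + 1).factorial := by exact_mod_cast (s + 1).factorial_pos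
  have hC : ∀ m ≤ s, |ρ₃ 2 m| ≤ 2 ^ toddBits S := fun m hm =>
    abs_le_of_eq_scaledTodd hsS hβb hm (m2 m hm)
  have hout := wp_outputProg (σ := ρ₃) (p := p) (s := s) (o := o) (a := a)
    (c := fun m => ρ₃ 2 m) (Q := ∏ j ∈ Finset.range s, -β j)
    (G := ((s + 1).factorial : ℤ) ^ s) (α := α) (F := ((s + 1).factorial : ℤ)) (u := u) (v := v) hb
    (by rw [r0]; exact hf) (by rw [r0]; exact hden) (by rw [r6, hp]) (by rw [r21, h21]) r13
    (fun m _ => rfl) m17 m23 (by rw [hf₃ 18 (by decide), hf₂ 18 (by decide), e18])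
    (by rw [hf₃ 14 (by decide), k14]) (by rw [r19, h19]) (by rw [r20, h20]) hsS hC
    (abs_factorial_le (by omega))
    (abs_prod_le_two_pow (fun i _ => by rw [abs_neg]; exact hβb i) hsS)
    (abs_pow_le_two_pow (abs_factorial_le (by omega)) (by omega)) hαb
    (pow_pos hFpos s) hQ0 hv hu' hv' ha ho
  refine wp_seq (wp_mono hout fun ρ₄ hf₄ ⟨n1, n2, n21, n20, nu, nv, nsum⟩ => ?_)
  have hval : (Expr.add (.add (.add (var 6) (.const 3)) (var 4)) (.mul (var 13) (var 4))).eval ρ₄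
      = ((p + 3 + n + s * n : ℕ) : ℤ) := by
    simp [Expr.eval, hf₄ 6 (by decide), hf₄ 4 (by decide), hf₄ 13 (by decide), r6, hp, r4, hn, r13]
  -- the fractions written are the weights
  have hw : ∀ l ≤ s, ((ρ₃ 2 (s - l : ℕ) * ((s + 1).factorial : ℤ) ^ l *
      ∏ j ∈ Finset.range s, -β j : ℤ) : ℚ) / (((s + 1).factorial : ℤ) ^ s * (l.factorial : ℤ) *
        ((∏ j ∈ Finset.range s, -β j) * ∏ j ∈ Finset.range s, -β j) : ℤ) = toddWeight s β l := by
    intro l hl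
    have hFq : ((s + 1).factorial : ℚ) ≠ 0 := by exact_mod_cast (s + 1).factorial_ne_zero
    have hlq : (l.factorial : ℚ) ≠ 0 := by exact_mod_cast l.factorial_ne_zero
    have hQq : ∏ j ∈ Finset.range s, (-(β j) : ℚ) ≠ 0 := by exact_mod_cast hQ0
    have hsl : ((s + 1).factorial : ℚ) ^ s =
        ((s + 1).factorial : ℚ) ^ (s - l) * ((s + 1).factorial : ℚ) ^ l := by
      rw [← pow_add, Nat.sub_add_cancel hl]
    push_cast
    rw [m2 _ (Nat.sub_le s l), scaledTodd_eq, toddWeight, hsl]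
    field_simp
  refine wp_setVar (by rw [hval]; exact (intSize_natCast_le _).trans (by omega))
    ⟨?_, fun l hl => ?_, fun y hy => ?_, ?_, ?_, ?_, ?_, ?_⟩
  · rw [hval]; simp [write_apply]
  · rw [write_of_ne _ _ _ (by decide), (n1 l hl).1, (n1 l hl).2]
    refine ⟨mul_pos (mul_pos (pow_pos hFpos s) (by exact_mod_cast l.factorial_pos))
      (mul_self_pos.2 hQ0), hw l hl⟩
  · rw [write_of_ne _ _ _ (by decide), n2 y hy, r1]
  · rw [write_of_ne _ _ _ (by decide), n21]
  · rw [write_of_ne _ _ _ (by decide)]; exact n20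
  · rw [write_of_ne _ _ _ (by decide)]; exact nu
  · rw [write_of_ne _ _ _ (by decide)]; exact nv
  · rw [write_of_ne _ _ _ (by decide), write_of_ne _ _ _ (by decide), nsum, r0, Finset.mul_sum]
    congr 1
    refine Finset.sum_congr rfl fun l hl => ?_
    rw [← hw l (Nat.lt_succ_iff.1 (Finset.mem_range.1 hl))]
end RAM

namespace RAM

/-- The input array `f` holds the data of `N` summands in dimension `n`, that of summand `i` from
address `p i` on, with `s i` denominator factors; all numbers are at most `2 ^ S` in absolute value,
and the data end at the address `p N ≤ S`. -/
structure Layout (S : ℕ) (f : ℤ → ℤ) (n N : ℕ) (s p : ℕ → ℕ) : Prop where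
  dim_eq : f 0 = n
  num_eq : f 1 = N
  p_zero : p 0 = 2
  p_succ : ∀ i < N, p (i + 1) = p i + 3 + n + s i * n
  s_eq : ∀ i < N, f (p i + 2) = s i
  den_pos : ∀ i < N, 0 < f (p i + 1)
  abs_le : ∀ y, |f y| ≤ 2 ^ S
  n_le : n ≤ S
  s_le : ∀ i < N, s i ≤ S
  p_le : p N ≤ S

namespace Layout

variable {S n N : ℕ} {f : ℤ → ℤ} {s p : ℕ → ℕ}

theorem p_add_le (h : Layout S f n N s p) {i : ℕ} (hi : i ≤ N) : p i + (N - i) ≤ S := by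
  induction hd : N - i generalizing i with
  | zero =>
    have : i = N := by omega
    subst this
    exact h.p_le
  | succ d ih =>
    have h1 := ih (i := i + 1) (by omega) (by omega)
    rw [h.p_succ i (by omega)] at h1
    omega

theorem N_le (h : Layout S f n N s p) : N ≤ S := by
  have := h.p_add_le (Nat.zero_le N)
  omega

end Layout

/-- The number `1 + ∑ f(k)²`, which exceeds the absolute values of the first `m` numbers. -/
def xi (f : ℤ → ℤ) (m : ℕ) : ℤ := 1 + ∑ k ∈ Finset.range m, f k * f k

theorem abs_xi_le {S m : ℕ} {f : ℤ → ℤ} (hf : ∀ y, |f y| ≤ 2 ^ S) (hm : m ≤ S) :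
    |xi f m| ≤ 2 ^ xiBits S := by
  have h := abs_sum_le_two_pow (y := fun k => f k * f k) (m := m)
    (fun k _ => abs_mul_le_two_pow (hf k) (hf k)) hm
  refine (abs_add_le _ _).trans ?_
  rw [xiBits, pow_succ, abs_one, show 3 * S = S + S + S by ring]
  have : (1 : ℤ) ≤ 2 ^ (S + S + S) := one_le_pow₀ (by norm_num)
  linarith

/-- The address of the first weight of summand `i` in the output. -/
def outPos (n : ℕ) (s : ℕ → ℕ) (i : ℕ) : ℕ := n + ∑ i' ∈ Finset.range i, 2 * (s i' + 1)

theorem outPos_succ (n : ℕ) (s : ℕ → ℕ) (i : ℕ) :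
    outPos n s (i + 1) = outPos n s i + 2 * (s i + 1) := by
  rw [outPos, Finset.sum_range_succ, ← add_assoc, ← outPos]

theorem outPos_le {S n N : ℕ} {f : ℤ → ℤ} {s p : ℕ → ℕ} (h : Layout S f n N s p) {i : ℕ}
    (hi : i ≤ N) : outPos n s i ≤ S + S * (2 * (S + 1)) := by
  refine Nat.add_le_add h.n_le ((Finset.sum_le_card_nsmul _ _ (2 * (S + 1)) fun i' hi' => ?_).trans
    ?_)
  · have := h.s_le i' (by have := Finset.mem_range.1 hi'; omega)
    omega
  · rw [Finset.card_range, smul_eq_mul]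
    exact Nat.mul_le_mul_right _ (hi.trans h.N_le)

theorem outPos_add_le (n : ℕ) (s : ℕ → ℕ) {i i' : ℕ} (hi : i < i') :
    outPos n s i + 2 * (s i + 1) ≤ outPos n s i' := by
  rw [← outPos_succ]
  exact Nat.add_le_add_left (Finset.sum_le_sum_of_subset (Finset.range_mono hi)) _

/-- The first part of the program: the length of the input, the number `ξ`, and the powers of `ξ`,
which are the first part of the output. -/
def lamProg : Prog :=
  .seq (setVar 4 (.read 0 (.const 0))) (.seq (setVar 5 (.read 0 (.const 1)))
  (.seq (setVar 6 (.const 2)) (.seq (forLoop 10 (var 5)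
    (setVar 6 (.add (.add (.add (var 6) (.const 3)) (var 4))
      (.mul (.read 0 (.add (var 6) (.const 2))) (var 4)))))
  (.seq (setVar 7 (.const 1)) (.seq (forLoop 9 (var 6)
    (setVar 7 (.add (var 7) (.mul (.read 0 (var 9)) (.read 0 (var 9))))))
  (.seq (setVar 15 (.const 1)) (.seq (forLoop 9 (var 4)
    (.seq (.assign 1 (var 9) (var 15)) (setVar 15 (.mul (var 15) (var 7)))))
  (.seq (setVar 6 (.const 2)) (.seq (setVar 21 (var 4)) (.seq (setVar 19 (.const 0))
    (setVar 20 (.const 1))))))))))))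

/-- The whole program. The powers of `ξ` and the weights are written to array `1`; the value at `1`
is the quotient of the variables `19` and `20`. -/
def mainProg : Prog := .seq lamProg (forLoop 10 (var 5) blockProg)

variable {b S n N : ℕ} {s p : ℕ → ℕ} {σ : Store}

theorem wp_lamProg (h : Layout S (σ 0) n N s p) (hb : bitBound S ≤ b) :
    WP (S + 1) b lamProg (fun τ => (∀ k < n, τ 1 k = xi (σ 0) (p N) ^ k) ∧ τ 4 0 = n ∧ τ 5 0 = N ∧
      τ 6 0 = 2 ∧ τ 21 0 = n ∧ τ 19 0 = 0 ∧ τ 20 0 = 1) σ := by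
  have hb' := hb
  unfold bitBound at hb'
  have hL : S + 1 + 1 ≤ b := by omega
  have nat : ∀ k : ℕ, k ≤ S → intSize (k : ℤ) ≤ b := fun k hk =>
    (intSize_natCast_le k).trans (by omega)
  have b0 : intSize 0 ≤ b := nat 0 (Nat.zero_le S)
  have b1 : intSize 1 ≤ b := (intSize_natCast_le 1).trans (by omega)
  have b2 : intSize 2 ≤ b := (intSize_natCast_le 2).trans (by omega)
  have v4 : (Expr.read 0 (.const 0)).eval σ = n := h.dim_eq
  refine wp_seq (wp_setVar (by rw [v4]; exact nat n h.n_le) ?_)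
  rw [v4]
  have v5 : (Expr.read 0 (.const 1)).eval (write σ 4 (Expr.eval σ (.const 0)) n) = N := by
    simpa [Expr.eval, write_apply] using h.num_eq
  refine wp_seq (wp_setVar (by erw [v5]; exact nat N h.N_le) ?_)
  erw [v5]
  refine wp_seq (wp_setVar b2 ?_)
  have a0 : write (write (write σ 4 0 n) 5 0 N) 6 0 2 0 = σ 0 := by
    rw [write_of_ne _ _ _ (by decide), write_of_ne _ _ _ (by decide), write_of_ne _ _ _ (by decide)]
  have a4 : write (write (write σ 4 0 n) 5 0 N) 6 0 2 4 0 = n := by simp [write_apply]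
  have a5 : write (write (write σ 4 0 n) 5 0 N) 6 0 2 5 0 = N := by simp [write_apply]
  have a6 : write (write (write σ 4 0 n) 5 0 N) 6 0 2 6 0 = 2 := by simp [write_apply]
  change WP (S + 1) b _ _ (write (write (write σ 4 0 n) 5 0 N) 6 0 2)
  generalize write (write (write σ 4 0 n) 5 0 N) 6 0 2 = σ₁ at a0 a4 a5 a6 ⊢
  -- the end of the input
  refine wp_seq (wp_forLoop (n := N) (fun i τ => τ 6 0 = p i) (h.N_le.trans (Nat.le_succ S)) hL
    (by decide) (fun τ hf => by simp [Expr.eval, hf 5 (by decide) (by decide), a5])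
    (by simp [write_apply, a6, h.p_zero]) (fun i hi τ hf _ hI => ?_) fun τ hf hI => ?_)
  · have hv : (Expr.add (.add (.add (var 6) (.const 3)) (var 4))
        (.mul (.read 0 (.add (var 6) (.const 2))) (var 4))).eval τ = (p (i + 1) : ℕ) := by
      simp [Expr.eval, hI, hf 4 (by decide) (by decide), hf 0 (by decide) (by decide), a0, a4,
        h.s_eq i hi, h.p_succ i hi]
    have := h.p_add_le (i := i + 1) (by omega)
    refine wp_setVar (by rw [hv]; exact nat _ (by omega)) ?_
    rw [hv]
    simp [write_apply]
  have c0 : τ 0 = σ 0 := (hf 0 (by decide) (by decide)).trans a0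
  have c4 : τ 4 0 = n := by rw [hf 4 (by decide) (by decide), a4]
  have c5 : τ 5 0 = N := by rw [hf 5 (by decide) (by decide), a5]
  clear hf
  -- the number `ξ`
  refine wp_seq (wp_setVar b1 (wp_seq (wp_forLoop (n := p N) (fun m τ => τ 7 0 = xi (σ 0) m)
    (h.p_le.trans (Nat.le_succ S)) hL
    (by decide) (fun ρ hf => by
      simp [Expr.eval, hf 6 (by decide) (by decide), write_of_ne, hI])
    (by simp [write_apply, xi, Expr.eval]) (fun m hm ρ hf hm0 hρ => ?_) fun ρ hf hρ => ?_)))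
  · have hv : (Expr.add (var 7) (.mul (.read 0 (var 9)) (.read 0 (var 9)))).eval ρ =
        xi (σ 0) (m + 1) := by
      simp [Expr.eval, hρ, hf 0 (by decide) (by decide), write_of_ne, c0, hm0, xi,
        Finset.sum_range_succ, add_assoc]
    refine wp_setVar (by
      rw [hv]
      refine intSize_le_of_abs_le (abs_xi_le h.abs_le ((Nat.succ_le_of_lt hm).trans h.p_le)) ?_
      have : xiBits S * 1 ≤ xiBits S * (S + 1) := Nat.mul_le_mul_left _ (by omega)
      omega) ?_
    rw [hv]
    simp [write_apply]
  have d4 : ρ 4 0 = n := by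
    rw [hf 4 (by decide) (by decide), write_of_ne _ _ _ (by decide), c4]
  have d5 : ρ 5 0 = N := by
    rw [hf 5 (by decide) (by decide), write_of_ne _ _ _ (by decide), c5]
  clear hf
  -- its powers
  refine wp_seq (wp_setVar b1 (wp_seq (wp_forLoop (n := n)
    (fun m τ => τ 15 0 = xi (σ 0) (p N) ^ m ∧ ∀ k < m, τ 1 k = xi (σ 0) (p N) ^ k)
    (h.n_le.trans (Nat.le_succ S)) hL
    (by decide) (fun υ hf => by
      simp [Expr.eval, hf 4 (by decide) (by decide), write_of_ne, d4])
    (by simp [write_apply, Expr.eval]) (fun m hm υ hf hm0 hυ => ?_) fun υ hf hυ => ?_)))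
  · have u7 : υ 7 0 = xi (σ 0) (p N) := by
      rw [hf 7 (by decide) (by decide), write_of_ne _ _ _ (by decide), hρ]
    have hx := abs_xi_le h.abs_le h.p_le
    have hS := h.n_le
    have hpw : ∀ k ≤ S + 1, intSize (xi (σ 0) (p N) ^ k) ≤ b := fun k hk =>
      intSize_le_of_abs_le (abs_pow_le_two_pow hx hk) (by omega)
    refine wp_seq (wp_assign ?_ (wp_setVar ?_ ⟨?_, fun k hk => ?_⟩))
    · simpa [Expr.eval, hυ.1] using hpw m (by omega)
    · simpa [Expr.eval, write_apply, hυ.1, u7, pow_succ] using hpw (m + 1) (by omega)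
    · simp [Expr.eval, write_apply, hυ.1, u7, pow_succ]
    · by_cases hkm : k = m
      · subst hkm
        simp [Expr.eval, write_apply, hm0, hυ.1]
      · have : k < m := by omega
        simp [Expr.eval, write_apply, hm0, hkm, hυ.2 k this]
  have e4 : υ 4 0 = n := by
    rw [hf 4 (by decide) (by decide), write_of_ne _ _ _ (by decide), d4]
  have e5 : υ 5 0 = N := by
    rw [hf 5 (by decide) (by decide), write_of_ne _ _ _ (by decide), d5]
  refine wp_seq (wp_setVar b2 (wp_seq (wp_setVar ?_ (wp_seq (wp_setVar b0 (wp_setVar b1 ?_))))))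
  · simpa [Expr.eval, write_apply, e4] using nat n h.n_le
  · refine ⟨fun k hk => ?_, ?_, ?_, ?_, ?_, ?_, ?_⟩
    · simpa [write_apply] using hυ.2 k hk
    all_goals simp [write_apply, Expr.eval, e4, e5]

/-- The effect of the whole program on an input with the given layout. -/
theorem wp_mainProg (h : Layout S (σ 0) n N s p) (hb : bitBound S ≤ b) {x : ℤ}
    (hx : x = xi (σ 0) (p N)) {α : ℕ → ℤ} (hα : ∀ i : ℕ, α i = dotAt x (σ 0) n (p i + 3))
    {β : ℕ → ℕ → ℤ} (hβ : ∀ i j : ℕ, β i j = dotAt x (σ 0) n (p i + 3 + n + j * n))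
    (hβ0 : ∀ i < N, ∀ j < s i, β i j ≠ 0) :
    WP (S + 1) b mainProg (fun τ => (∀ k < n, τ 1 k = x ^ k) ∧
      (∀ i < N, ∀ l ≤ s i, 0 < τ 1 (outPos n s i + 2 * l + 1) ∧
        (τ 1 (outPos n s i + 2 * l) / τ 1 (outPos n s i + 2 * l + 1) : ℚ) =
          toddWeight (s i) (β i) l) ∧
      0 < τ 20 0 ∧ (τ 19 0 / τ 20 0 : ℚ) = ∑ i ∈ Finset.range N,
        (σ 0 (p i) / σ 0 (p i + 1) : ℚ) *
          ∑ l ∈ Finset.range (s i + 1), toddWeight (s i) (β i) l * (α i : ℚ) ^ l) σ := by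
  have hb' := hb
  unfold bitBound at hb'
  have hL : S + 1 + 1 ≤ b := by omega
  have hxb : |x| ≤ 2 ^ xiBits S := by rw [hx]; exact abs_xi_le h.abs_le h.p_le
  refine wp_seq (wp_mono (wp_lamProg h hb) fun σ₁ hf₁ ⟨a1, a4, a5, a6, a21, a19, a20⟩ => ?_)
  have a0 : σ₁ 0 = σ 0 := hf₁ 0 (by decide)
  rw [← hx] at a1
  refine wp_forLoop (n := N) (fun i τ => (∀ k < n, τ 1 k = x ^ k) ∧ τ 6 0 = p i ∧
    τ 21 0 = outPos n s i ∧ (∀ i' < i, ∀ l ≤ s i', 0 < τ 1 (outPos n s i' + 2 * l + 1) ∧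
        (τ 1 (outPos n s i' + 2 * l) / τ 1 (outPos n s i' + 2 * l + 1) : ℚ) =
          toddWeight (s i') (β i') l) ∧
      0 < τ 20 0 ∧ |τ 19 0| ≤ 2 ^ (termBits S * (i * (S + 1))) ∧
      |τ 20 0| ≤ 2 ^ (termBits S * (i * (S + 1))) ∧
      (τ 19 0 / τ 20 0 : ℚ) = ∑ i' ∈ Finset.range i,
        (σ 0 (p i') / σ 0 (p i' + 1) : ℚ) *
          ∑ l ∈ Finset.range (s i' + 1), toddWeight (s i') (β i') l * (α i' : ℚ) ^ l)
    (h.N_le.trans (Nat.le_succ S)) hL (by decide) ?_ ?_ ?_ ?_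
  · intro τ hf
    simp [Expr.eval, hf 5 (by decide) (by decide), a5]
  · simp only [write_of_ne σ₁ (x := 10) (y := 1) _ _ (by decide),
      write_of_ne σ₁ (x := 10) (y := 6) _ _ (by decide),
      write_of_ne σ₁ (x := 10) (y := 21) _ _ (by decide),
      write_of_ne σ₁ (x := 10) (y := 19) _ _ (by decide),
      write_of_ne σ₁ (x := 10) (y := 20) _ _ (by decide)]
    refine ⟨a1, ?_, ?_, fun i' hi' => absurd hi' (by omega), ?_, ?_, ?_, ?_⟩
    · rw [a6, h.p_zero]; rfl
    · rw [a21, outPos]; simp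
    · rw [a20]; norm_num
    · rw [a19]; simp
    · rw [a20]; simp
    · rw [a19]; simp
  · rintro i hi τ hf hi0 ⟨i1, i6, i21, iw, i20, iu, iv, isum⟩
    have t0 : τ 0 = σ 0 := (hf 0 (by decide) (by decide)).trans a0
    have hend : p i + 3 + n + s i * n ≤ S := by
      rw [← h.p_succ i hi]
      have := h.p_add_le (i := i + 1) (by omega)
      omega
    have hexp : termBits S * (i * (S + 1)) + termBits S * (s i + 1) ≤
        termBits S * ((i + 1) * (S + 1)) := by
      rw [← mul_add, add_mul i 1, one_mul]
      have := h.s_le i hi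
      exact Nat.mul_le_mul_left _ (by omega)
    have hexp' : termBits S * ((i + 1) * (S + 1)) ≤ termBits S * ((S + 1) * (S + 1)) :=
      Nat.mul_le_mul_left _ (Nat.mul_le_mul_right _ (by have := h.N_le; omega))
    have hout := outPos_le h (i := i + 1) (by omega)
    rw [outPos_succ] at hout
    have hSS : S * (2 * (S + 1)) ≤ 10 * (S + 1) * (S + 1) := by nlinarith
    have hblock := wp_blockProg (σ := τ) (n := n) (p := p i) (s := s i) (o := outPos n s i)
      (a := termBits S * (i * (S + 1))) (x := x) (α := α i) (u := τ 19 0) (v := τ 20 0) (β := β i)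
      hb (by rw [t0]; exact h.abs_le) hxb i1
      (by rw [hf 4 (by decide) (by decide), a4]) i6 (by rw [t0]; exact h.s_eq i hi)
      (by rw [t0]; exact h.den_pos i hi) i21 rfl rfl h.n_le (h.s_le i hi) hend
      (by rw [t0]; exact hα i) (by rw [t0]; exact hβ i) (hβ0 i hi) i20 iu iv (by omega) (by omega)
    refine wp_mono hblock fun ρ _ ⟨k6, kw, k1, k21, k20, ku, kv, ksum⟩ => ?_
    simp only [write_of_ne ρ (x := 10) (y := 1) _ _ (by decide),
      write_of_ne ρ (x := 10) (y := 6) _ _ (by decide),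
      write_of_ne ρ (x := 10) (y := 21) _ _ (by decide),
      write_of_ne ρ (x := 10) (y := 19) _ _ (by decide),
      write_of_ne ρ (x := 10) (y := 20) _ _ (by decide)]
    refine ⟨fun k hk => ?_, ?_, ?_, fun i' hi' l hl => ?_, k20, ?_, ?_, ?_⟩
    · have hno : n ≤ outPos n s i := Nat.le_add_right _ _
      have : (k : ℤ) < (outPos n s i : ℕ) := by exact_mod_cast hk.trans_le hno
      rw [k1 k this, i1 k hk]
    · rw [k6, h.p_succ i hi]
    · rw [k21, outPos_succ]
    · rcases Nat.lt_succ_iff_lt_or_eq.1 hi' with hlt | rfl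
      · have := outPos_add_le n s hlt
        rw [k1 _ (by omega), k1 _ (by omega)]
        exact iw i' hlt l hl
      · exact kw l hl
    · exact ku.trans (pow_le_pow_right₀ (by norm_num) hexp)
    · exact kv.trans (pow_le_pow_right₀ (by norm_num) hexp)
    · rw [Finset.sum_range_succ, ksum, isum, t0]
  · exact fun τ _ hI => ⟨hI.1, hI.2.2.2.1, hI.2.2.2.2.1, hI.2.2.2.2.2.2.2⟩

end RAM

namespace RAM

/-! ### Polynomial bounds -/

/-- Functions of one natural number that are given by a polynomial. -/
def IsPoly (g : ℕ → ℕ) : Prop := ∃ q : Polynomial ℕ, ∀ S, g S = q.eval S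

namespace IsPoly

variable {g h : ℕ → ℕ}

theorem const (c : ℕ) : IsPoly fun _ => c := ⟨Polynomial.C c, fun S => by simp⟩

theorem id : IsPoly fun S => S := ⟨Polynomial.X, fun S => by simp⟩

theorem add (hg : IsPoly g) (hh : IsPoly h) : IsPoly fun S => g S + h S := by
  obtain ⟨p, hp⟩ := hg
  obtain ⟨q, hq⟩ := hh
  exact ⟨p + q, fun S => by simp [hp, hq]⟩

theorem mul (hg : IsPoly g) (hh : IsPoly h) : IsPoly fun S => g S * h S := by
  obtain ⟨p, hp⟩ := hg
  obtain ⟨q, hq⟩ := hh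
  exact ⟨p * q, fun S => by simp [hp, hq]⟩

theorem pow (hg : IsPoly g) (m : ℕ) : IsPoly fun S => g S ^ m := by
  obtain ⟨p, hp⟩ := hg
  exact ⟨p ^ m, fun S => by simp [hp]⟩

theorem price (P : Prog) (hg : IsPoly g) : IsPoly fun S => P.price (g S) := by
  obtain ⟨p, hp⟩ := P.exists_polynomial_price
  obtain ⟨q, hq⟩ := hg
  exact ⟨p.comp q, fun S => by simp [hp, hq]⟩

theorem bitBound : IsPoly bitBound := by
  have s1 : IsPoly fun S => S + 1 := id.add (const 1)
  have hxi : IsPoly xiBits := ((const 3).mul id).add (const 1)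
  have hdot : IsPoly dotBits := (hxi.mul id).add ((const 2).mul id)
  have hfac : IsPoly facBits := (id.add (const 2)).mul (id.add (const 2))
  have hpow : IsPoly powBits := (hfac.add hdot).mul s1
  have htodd : IsPoly toddBits := (hpow.add (const 1)).mul (id.mul id)
  have hnum : IsPoly numBits := (htodd.add (hfac.mul s1)).add (hdot.mul id)
  have hden : IsPoly denBits :=
    ((hfac.mul s1).add hfac).add ((hdot.mul id).add (hdot.mul id))
  have hterm : IsPoly termBits := (((id.add hnum).add hden).add (hdot.mul s1)).add (const 1)
  exact (((((((((((id.add (hxi.mul s1)).add hdot).add hfac).add hpow).add htodd).add hnum).add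
    hden).add (hterm.mul (s1.mul s1))).add (((const 10).mul s1).mul s1)).add (hdot.mul s1)).add
    (hfac.mul s1)).add (const 10)

end IsPoly

/-! ### Lists in the memory -/

/-- The list `L` stands in the array `f` from address `q` on. -/
def HoldsAt (f : ℤ → ℤ) (q : ℕ) (L : List ℤ) : Prop :=
  ∀ (k : ℕ) (hk : k < L.length), f (q + k) = L[k]

variable {f : ℤ → ℤ}

theorem holdsAt_append {q : ℕ} {L L' : List ℤ} :
    HoldsAt f q (L ++ L') ↔ HoldsAt f q L ∧ HoldsAt f (q + L.length) L' := by
  refine ⟨fun h => ⟨fun k hk => ?_, fun k hk => ?_⟩, fun ⟨h, h'⟩ k hk => ?_⟩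
  · rw [h k (by simp; omega), List.getElem_append_left hk]
  · have := h (L.length + k) (by simp; omega)
    rw [List.getElem_append_right (by omega)] at this
    simp only [Nat.add_sub_cancel_left] at this
    rw [← this]
    push_cast
    ring_nf
  · by_cases hkL : k < L.length
    · rw [List.getElem_append_left hkL, h k hkL]
    · rw [List.getElem_append_right (by omega), ← h' (k - L.length) (by simp at hk; omega)]
      congr 1
      omega

theorem holdsAt_ofFn {q m : ℕ} {g : Fin m → ℤ} :
    HoldsAt f q (List.ofFn g) ↔ ∀ k : Fin m, f (q + k) = g k := by
  refine ⟨fun h k => ?_, fun h k hk => ?_⟩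
  · rw [h k (by simp)]; simp
  · simpa using h ⟨k, by simpa using hk⟩

theorem length_flatten_ofFn {m : ℕ} (g : Fin m → List ℤ) (q : ℕ → ℕ)
    (hq : ∀ i : Fin m, q (i + 1) = q i + (g i).length) :
    q 0 + (List.ofFn g).flatten.length = q m := by
  induction m generalizing q with
  | zero => simp
  | succ m ih =>
    have h := ih (fun i => g i.succ) (fun i => q (i + 1)) fun i => by simpa using hq i.succ
    have h0 := hq 0
    simp only [Fin.val_zero, zero_add] at h0 h
    rw [List.ofFn_succ, List.flatten_cons, List.length_append, ← add_assoc, ← h0, h]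

theorem holdsAt_flatten_ofFn {m : ℕ} (g : Fin m → List ℤ) (q : ℕ → ℕ)
    (hq : ∀ i : Fin m, q (i + 1) = q i + (g i).length) :
    HoldsAt f (q 0) (List.ofFn g).flatten ↔ ∀ i : Fin m, HoldsAt f (q i) (g i) := by
  induction m generalizing q with
  | zero => simp [HoldsAt]
  | succ m ih =>
    have h := ih (fun i => g i.succ) (fun i => q (i + 1)) fun i => by simpa using hq i.succ
    have h0 := hq 0
    simp only [Fin.val_zero, zero_add] at h0 h
    rw [List.ofFn_succ, List.flatten_cons, holdsAt_append, ← h0, h, Fin.forall_fin_succ]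
    simp

theorem hasOutput_iff {τ : Store} {L : List ℤ} : HasOutput τ L ↔ HoldsAt (τ 1) 0 L := by
  simp [HasOutput, HoldsAt]

theorem holdsAt_input (L : List ℤ) : HoldsAt (input L 0) 0 L := fun k hk => by
  simp [input, hk]

theorem length_le_sum_intSize (L : List ℤ) : L.length ≤ (L.map intSize).sum := by
  induction L with
  | nil => simp
  | cons z L ih =>
    have := one_le_intSize z
    simp only [List.length_cons, List.map_cons, List.sum_cons]
    omega

/-- The cells outside of the list contain `0`, whose length is `1`; hence the summand `1`. -/
theorem intSize_input_le (L : List ℤ) (x : ℕ) (y : ℤ) :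
    intSize (input L x y) ≤ (L.map intSize).sum + 1 := by
  have h0 : intSize 0 ≤ (L.map intSize).sum + 1 := by simp [intSize]
  unfold input
  split_ifs
  · rw [List.getD_eq_getElem?_getD]
    rcases lt_or_ge y.toNat L.length with h | h
    · rw [List.getElem?_eq_getElem h, Option.getD_some]
      exact (List.le_sum_of_mem (List.mem_map_of_mem (List.getElem_mem h))).trans (Nat.le_succ _)
    · rw [List.getElem?_eq_none h, Option.getD_none]
      exact h0
  · exact h0

end RAM

/-- A nonzero integer vector is not orthogonal to `(1, x, x², …)` if `x` exceeds its entries. -/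
theorem sum_pow_mul_ne_zero {n : ℕ} {x : ℤ} {a : Fin n → ℤ} (hx : ∀ k, |a k| < x) (ha : a ≠ 0) :
    ∑ k : Fin n, x ^ (k : ℕ) * a k ≠ 0 := by
  induction n with
  | zero => exact absurd (Subsingleton.elim a 0) ha
  | succ n ih =>
    intro h
    rw [Fin.sum_univ_succ] at h
    have hs : ∑ k : Fin n, x ^ ((Fin.succ k : Fin (n + 1)) : ℕ) * a k.succ =
        x * ∑ k : Fin n, x ^ (k : ℕ) * a k.succ := by
      rw [Finset.mul_sum]
      exact Finset.sum_congr rfl fun k _ => by rw [Fin.val_succ, pow_succ]; ring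
    rw [hs] at h
    simp only [Fin.val_zero, pow_zero, one_mul] at h
    have h0 : a 0 = 0 := Int.eq_zero_of_abs_lt_dvd
      ⟨-∑ k : Fin n, x ^ (k : ℕ) * a k.succ, by linarith⟩ (hx 0)
    have hx0 : x ≠ 0 := by have := (abs_nonneg (a 0)).trans_lt (hx 0); omega
    rw [h0, zero_add] at h
    refine ih (a := fun k => a k.succ) (fun k => hx _) (fun h1 => ha ?_)
      ((mul_eq_zero.1 h).resolve_left hx0)
    funext k
    refine Fin.cases h0 (fun k => congrFun h1 k) k

/-! ### The program on encoded data -/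

namespace RationalSum

open RAM

variable (D : RationalSum)

/-- The numbers `s_i`, indexed by natural numbers. -/
def binomials (i : ℕ) : ℕ := if h : i < D.N then D.s ⟨i, h⟩ else 0

/-- The address at which the data of summand `i` begin. -/
def pos : ℕ → ℕ
  | 0 => 2
  | i + 1 => pos i + 3 + D.n + D.binomials i * D.n

/-- The contents of the memory that hold the input. -/
def mem : ℤ → ℤ := input D.encode 0

theorem binomials_val (i : Fin D.N) : D.binomials i = D.s i := by simp [binomials]

/-- The data of one summand in the encoding. -/
def block (i : Fin D.N) : List ℤ :=
  [(D.ε i).num, ((D.ε i).den : ℤ), (D.s i : ℤ)] ++ List.ofFn (D.a i) ++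
    (List.ofFn fun j => List.ofFn (D.b i j)).flatten

theorem encode_eq : D.encode = [(D.n : ℤ), (D.N : ℤ)] ++ (List.ofFn D.block).flatten := rfl

theorem pos_succ (i : Fin D.N) : D.pos (i + 1) = D.pos i + (D.block i).length := by
  have h := length_flatten_ofFn (fun j => List.ofFn (D.b i j)) (fun j => j * D.n)
    fun j => by simp [add_mul]
  simp only [zero_mul, zero_add] at h
  rw [pos, binomials_val, block, List.length_append, List.length_append, List.length_ofFn, h]
  simp only [List.length_cons, List.length_nil]
  omega

theorem length_encode : D.encode.length = D.pos D.N := by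
  rw [← length_flatten_ofFn D.block D.pos D.pos_succ, encode_eq, List.length_append]
  rfl

theorem mem_head : D.mem 0 = D.n ∧ D.mem 1 = D.N := by
  have h : HoldsAt D.mem 0 D.encode := holdsAt_input D.encode
  rw [encode_eq, holdsAt_append] at h
  exact ⟨h.1 0 (by simp), h.1 1 (by simp)⟩

theorem mem_block (i : Fin D.N) : D.mem (D.pos i) = (D.ε i).num ∧
    D.mem (D.pos i + 1) = (D.ε i).den ∧ D.mem (D.pos i + 2) = D.s i ∧
    (∀ k : Fin D.n, D.mem (D.pos i + 3 + k) = D.a i k) ∧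
    ∀ (j : Fin (D.s i)) (k : Fin D.n), D.mem (D.pos i + 3 + D.n + j * D.n + k) = D.b i j k := by
  have h : HoldsAt D.mem 0 D.encode := holdsAt_input D.encode
  rw [encode_eq, holdsAt_append] at h
  have hi := (holdsAt_flatten_ofFn D.block D.pos D.pos_succ).1 h.2 i
  rw [block, holdsAt_append, holdsAt_append, holdsAt_ofFn] at hi
  obtain ⟨⟨h1, h2⟩, h3⟩ := hi
  have h3' := (holdsAt_flatten_ofFn (fun j => List.ofFn (D.b i j))
    (fun j => D.pos i + 3 + D.n + j * D.n) (fun j => by simp; ring)).1 (by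
      convert h3 using 1
      simp only [List.length_append, List.length_ofFn, List.length_cons, List.length_nil]
      omega)
  refine ⟨?_, h1 1 (by simp), h1 2 (by simp), fun k => ?_, fun j k => ?_⟩
  · simpa using h1 0 (by simp)
  · simpa using h2 k
  · have := holdsAt_ofFn.1 (h3' j) k
    push_cast at this
    exact this

theorem length_encode_le_size : D.encode.length ≤ D.size :=
  (length_le_sum_intSize _).trans (Nat.le_add_left _ _)

theorem intSize_input_encode_le (x : ℕ) (y : ℤ) : intSize (input D.encode x y) ≤ D.size + 1 :=
  (intSize_input_le _ x y).trans (Nat.succ_le_succ (Nat.le_add_left _ _))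

theorem pos_mono : Monotone D.pos := monotone_nat_of_le_succ fun k => by rw [pos]; omega

theorem layout : Layout D.size D.mem D.n D.N D.binomials D.pos where
  dim_eq := D.mem_head.1
  num_eq := D.mem_head.2
  p_zero := rfl
  p_succ _ _ := rfl
  s_eq i hi := by
    rw [(D.mem_block ⟨i, hi⟩).2.2.1]
    simp [binomials, hi]
  den_pos i hi := by
    rw [(D.mem_block ⟨i, hi⟩).2.1]
    exact_mod_cast (D.ε ⟨i, hi⟩).den_pos
  abs_le y := abs_le_two_pow_of_intSize_le (D.intSize_input_encode_le 0 y)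
  n_le := Nat.le_add_right _ _
  s_le i hi := by
    -- if there is a nonzero vector `b_ij`, then `1 ≤ n`, and all of them are in the list
    have h1 : D.pos (i + 1) ≤ D.pos D.N := D.pos_mono hi
    have h2 := D.length_encode_le_size
    rw [length_encode] at h2
    rw [pos] at h1
    rcases Nat.eq_zero_or_pos (D.binomials i) with h0 | h0
    · omega
    · have hs : 0 < D.s ⟨i, hi⟩ := by rwa [← binomials_val]
      have hn : 0 < D.n := by
        by_contra hn
        refine D.b_ne_zero ⟨i, hi⟩ ⟨0, hs⟩ (funext fun k => ?_)
        exact absurd k.2 (by omega)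
      have := Nat.le_mul_of_pos_right (D.binomials i) hn
      omega
  p_le := by rw [← length_encode]; exact D.length_encode_le_size

/-- The number `ξ` computed by the program. -/
def xiVal : ℤ := xi D.mem (D.pos D.N)

/-- The vector `(1, ξ, ξ², …)` computed by the program. -/
def lamVal (k : Fin D.n) : ℤ := D.xiVal ^ (k : ℕ)

/-- The vector `lamVal`, with rational coordinates. -/
def lamRat (k : Fin D.n) : ℚ := D.lamVal k

/-- The pairings of `lamVal` with the vectors `a_i`, indexed by natural numbers. -/
def alphaVal (i : ℕ) : ℤ := dotAt D.xiVal D.mem D.n (D.pos i + 3)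

/-- The pairings of `lamVal` with the vectors `b_ij`, indexed by natural numbers. -/
def betaVal (i j : ℕ) : ℤ := dotAt D.xiVal D.mem D.n (D.pos i + 3 + D.n + j * D.n)

theorem alphaVal_eq (i : Fin D.N) : (D.alphaVal i : ℚ) = pairing D.lamRat (D.a i) := by
  rw [alphaVal, dotAt, Finset.sum_range, pairing]
  push_cast
  refine Finset.sum_congr rfl fun k _ => ?_
  rw [(D.mem_block i).2.2.2.1 k, lamRat, lamVal]
  push_cast
  rfl

theorem betaVal_eq_sum (i : Fin D.N) (j : Fin (D.s i)) :
    D.betaVal i j = ∑ k : Fin D.n, D.xiVal ^ (k : ℕ) * D.b i j k := by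
  rw [betaVal, dotAt, Finset.sum_range]
  exact Finset.sum_congr rfl fun k _ => by rw [(D.mem_block i).2.2.2.2 j k]

theorem betaVal_eq (i : Fin D.N) (j : Fin (D.s i)) :
    (D.betaVal i j : ℚ) = pairing D.lamRat (D.b i j) := by
  rw [betaVal_eq_sum, pairing]
  push_cast
  exact Finset.sum_congr rfl fun k _ => by rw [lamRat, lamVal]; push_cast; rfl

/-- The coordinate is one of the numbers whose squares are summed in `ξ`. -/
theorem abs_b_lt_xiVal (i : Fin D.N) (j : Fin (D.s i)) (k : Fin D.n) :
    |D.b i j k| < D.xiVal := by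
  have hlt : D.pos i + 3 + D.n + j * D.n + k < D.pos D.N := by
    have h1 : D.pos (i + 1) ≤ D.pos D.N := D.pos_mono i.2
    rw [pos, binomials_val] at h1
    have h2 : ((j : ℕ) + 1) * D.n ≤ D.s i * D.n := Nat.mul_le_mul_right _ j.2
    have := k.2
    rw [add_mul] at h2
    omega
  have h := Finset.single_le_sum (f := fun m : ℕ => D.mem m * D.mem m)
    (fun m _ => mul_self_nonneg _) (Finset.mem_range.2 hlt)
  have hb := (D.mem_block i).2.2.2.2 j k
  push_cast at h
  rw [hb] at h
  rw [xiVal, xi]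
  have h3 : |D.b i j k| ≤ D.b i j k * D.b i j k := by
    rw [← abs_mul_abs_self]
    rcases (abs_nonneg (D.b i j k)).eq_or_lt with h0 | h0
    · rw [← h0]; simp
    · exact le_mul_of_one_le_left h0.le h0
  linarith

theorem betaVal_ne_zero (i : ℕ) (hi : i < D.N) (j : ℕ) (hj : j < D.binomials i) :
    D.betaVal i j ≠ 0 := by
  have hj' : j < D.s ⟨i, hi⟩ := by rwa [← binomials_val]
  rw [D.betaVal_eq_sum ⟨i, hi⟩ ⟨j, hj'⟩]
  exact sum_pow_mul_ne_zero (D.abs_b_lt_xiVal ⟨i, hi⟩ ⟨j, hj'⟩) (D.b_ne_zero _ _)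

theorem pairing_lamRat_ne_zero (i : Fin D.N) (j : Fin (D.s i)) :
    pairing D.lamRat (D.b i j) ≠ 0 := by
  rw [← betaVal_eq]
  exact_mod_cast D.betaVal_ne_zero i i.2 j (by rw [binomials_val]; exact j.2)

/-- The sign `(-1) ^ s_i` in the weight accounts for the product of the `-β_j` in `toddWeight`. -/
theorem toddWeight_eq_weight (i : Fin D.N) (l : ℕ) :
    toddWeight (D.binomials i) (D.betaVal i) l = D.weight D.lamRat i l := by
  have hs := D.binomials_val i
  rw [toddWeight, weight, hs, Finset.prod_range]
  simp only [betaVal_eq]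
  have h1 : ((-1 : ℚ) ^ D.s i) * (-1) ^ D.s i = 1 := by rw [← mul_pow]; simp
  have h1' : ((-1 : ℚ) ^ D.s i)⁻¹ = (-1) ^ D.s i := inv_eq_of_mul_eq_one_left h1
  rw [Finset.prod_neg, Finset.card_univ, Fintype.card_fin, div_eq_mul_inv, div_eq_mul_inv,
    mul_left_comm, mul_inv ((-1 : ℚ) ^ D.s i), h1']
  ring

/-- The final memory of the program on the given data. -/
theorem wp_mainProg_encode {b : ℕ} (hb : bitBound D.size ≤ b) :
    WP (D.size + 1) b mainProg (fun τ => (∀ k : Fin D.n, τ 1 k = D.lamVal k) ∧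
      (∀ i : Fin D.N, ∀ l ≤ D.s i, 0 < τ 1 (outPos D.n D.binomials i + 2 * l + 1) ∧
        (τ 1 (outPos D.n D.binomials i + 2 * l) / τ 1 (outPos D.n D.binomials i + 2 * l + 1) : ℚ) =
          D.weight D.lamRat i l) ∧
      0 < τ 20 0 ∧ (τ 19 0 / τ 20 0 : ℚ) = ∑ i, D.ε i *
          ∑ l ∈ Finset.range (D.s i + 1), D.weight D.lamRat i l * pairing D.lamRat (D.a i) ^ l)
      (input D.encode) := by
  refine wp_mono (wp_mainProg (σ := input D.encode) D.layout hb (x := D.xiVal) rfl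
    (α := D.alphaVal) (fun _ => rfl) (β := D.betaVal) (fun _ _ => rfl) D.betaVal_ne_zero)
    fun τ _ ⟨h1, hw, h20, hsum⟩ => ⟨fun k => h1 k k.2, fun i l hl => ?_, h20, ?_⟩
  · have := hw i i.2 l (by rwa [binomials_val])
    rwa [toddWeight_eq_weight] at this
  · rw [hsum, Finset.sum_range]
    refine Finset.sum_congr rfl fun i _ => ?_
    have hε : (D.mem (D.pos i) / D.mem (D.pos i + 1) : ℚ) = D.ε i := by
      rw [(D.mem_block i).1, (D.mem_block i).2.1]
      exact_mod_cast Rat.num_div_den (D.ε i)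
    change (D.mem (D.pos i) / D.mem (D.pos i + 1) : ℚ) * _ = _
    rw [hε, binomials_val, alphaVal_eq]
    congr 1
    refine Finset.sum_congr rfl fun l _ => ?_
    rw [← toddWeight_eq_weight, binomials_val]

theorem bounded_input {b : ℕ} (hb : bitBound D.size ≤ b) : Bounded b (input D.encode) :=
  fun x y => (D.intSize_input_encode_le x y).trans (by unfold bitBound at hb; omega)

end RationalSum

/-- The main program, followed by the output of the accumulated fraction. -/
def RAM.valueProg : RAM.Prog :=
  .seq mainProg (.seq (.assign 1 (.const 0) (var 19)) (.assign 1 (.const 1) (var 20)))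

/-- A program whose loops make at most `S + 1` passes on numbers of length at most `bitBound S` runs in
polynomial time. -/
theorem RAM.exists_polynomial_time (P : RAM.Prog) : ∃ p : Polynomial ℕ, ∀ S,
    P.price (S + 1) * bitBound S ^ 2 = p.eval S :=
  (IsPoly.price P (IsPoly.id.add (IsPoly.const 1))).mul (IsPoly.bitBound.pow 2)

theorem mainTheorem3 :
    -- (a) polynomial-time specialization at the removable singularity
    (∃ (A : RAM.Prog) (p : Polynomial ℕ), ∀ (D : RationalSum) (c : ℚ),
      HasValueAtOne D.toRationalFunction c →
      ∃ num den : ℤ, 0 < den ∧ c = (num : ℚ) / (den : ℚ) ∧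
        RAM.OutputsWithin A D.encode (p.eval D.size) [num, den]) ∧
    -- (b) polynomial-time computation of `lam` and of the weights, and the resulting formula
    (∃ (A : RAM.Prog) (p : Polynomial ℕ), ∀ D : RationalSum,
      ∃ (lam : Fin D.n → ℤ) (num den : (i : Fin D.N) → Fin (D.s i + 1) → ℤ)
        (w : (i : Fin D.N) → Fin (D.s i + 1) → ℚ),
        RAM.OutputsWithin A D.encode (p.eval D.size)
          (List.ofFn lam ++
            (List.ofFn fun i => (List.ofFn fun l => [num i l, den i l]).flatten).flatten) ∧
        (∀ i l, 0 < den i l ∧ w i l = (num i l : ℚ) / (den i l : ℚ)) ∧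
        (∃ ξ : ℤ, ∀ k, lam k = ξ ^ (k : ℕ)) ∧
        (∀ i j, pairing (fun k => (lam k : ℚ)) (D.b i j) ≠ 0) ∧
        (∀ i l, w i l = D.weight (fun k => (lam k : ℚ)) i l) ∧
        (∀ c : ℚ, HasValueAtOne D.toRationalFunction c →
          c = ∑ i, D.ε i * ∑ l, w i l * pairing (fun k => (lam k : ℚ)) (D.a i) ^ (l : ℕ)) ∧
        (∀ P : Set (Fin D.n → ℝ), IsPolytope P →
          generatingFunction P = D.toRationalFunction →
          ((latticePoints P).ncard : ℚ) =
            ∑ i, D.ε i * ∑ l, w i l * pairing (fun k => (lam k : ℚ)) (D.a i) ^ (l : ℕ))) ∧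
    -- (c) the explicit formula for the Ehrhart polynomial
    (∀ (D : RationalSum) (v : Fin D.N → Fin D.n → ℤ) (P : Set (Fin D.n → ℝ)),
      IsIntegralPolytope P →
      (∀ k : ℕ, 0 < k →
        generatingFunction ((k : ℝ) • P) = (D.dilate v k).toRationalFunction) →
      ∀ lam : Fin D.n → ℚ, (∀ i j, pairing lam (D.b i j) ≠ 0) →
        IsEhrhartPolynomial P
          (∑ m ∈ Finset.range (min D.maxS (polytopeDim P) + 1),
            Polynomial.C
              (∑ i, D.ε i * pairing lam (v i) ^ m *
                ∑ l ∈ Finset.Icc m (D.s i),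
                  (l.choose m : ℚ) * D.weight lam i l *
                    pairing lam (D.a i - v i) ^ (l - m)) *
            Polynomial.X ^ m)) := by
  refine ⟨?_, ?_, fun D v P hP hg lam hlam => D.isEhrhartPolynomial v P hP hg lam hlam⟩
  · obtain ⟨p, hp⟩ := RAM.exists_polynomial_time RAM.valueProg
    refine ⟨RAM.valueProg, p, fun D c hc => ?_⟩
    have hprog : RAM.WP (D.size + 1) (RAM.bitBound D.size) RAM.valueProg (fun τ => 0 < τ 1 1 ∧
        c = (τ 1 0 : ℚ) / (τ 1 1 : ℚ)) (RAM.input D.encode) := by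
      refine RAM.wp_seq (RAM.wp_mono (D.wp_mainProg_encode le_rfl) fun τ _ ⟨_, _, h20, hsum⟩ => ?_)
      refine fun hτ => (RAM.wp_seq (RAM.wp_assign (hτ 19 0) (RAM.wp_assign ?_ ⟨?_, ?_⟩))) hτ
      · simpa [RAM.Expr.eval, RAM.write_apply] using hτ 20 0
      · simpa [RAM.Expr.eval, RAM.write_apply] using h20
      · simpa [RAM.Expr.eval, RAM.write_apply, hsum] using
          D.eq_sum_of_hasValueAtOne hc D.pairing_lamRat_ne_zero
    obtain ⟨t, τ, he, ht, _, hpos, hval⟩ := hprog (D.bounded_input le_rfl)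
    refine ⟨τ 1 0, τ 1 1, hpos, hval, t, τ, he, ht.trans_eq (hp _), fun k hk => ?_⟩
    rcases k with _ | _ | k
    · rfl
    · rfl
    · simp at hk
  · obtain ⟨p, hp⟩ := RAM.exists_polynomial_time RAM.mainProg
    refine ⟨RAM.mainProg, p, fun D => ?_⟩
    obtain ⟨t, τ, he, ht, _, hlam, hw, _, _⟩ :=
      D.wp_mainProg_encode le_rfl (D.bounded_input le_rfl)
    have hval : ∀ c : ℚ, HasValueAtOne D.toRationalFunction c → c = ∑ i, D.ε i *
        ∑ l : Fin (D.s i + 1), D.weight D.lamRat i l * pairing D.lamRat (D.a i) ^ (l : ℕ) :=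
      fun c hc => by
        rw [D.eq_sum_of_hasValueAtOne hc D.pairing_lamRat_ne_zero]
        simp only [Finset.sum_range]
    refine ⟨D.lamVal, fun i l => τ 1 (RAM.outPos D.n D.binomials i + 2 * (l : ℕ)),
      fun i l => τ 1 (RAM.outPos D.n D.binomials i + 2 * (l : ℕ) + 1),
      fun i l => D.weight D.lamRat i l, ⟨t, τ, he, ht.trans_eq (hp _), ?_⟩,
      fun i l => ⟨(hw i l (Nat.lt_succ_iff.1 l.2)).1, (hw i l (Nat.lt_succ_iff.1 l.2)).2.symm⟩,
      ⟨D.xiVal, fun _ => rfl⟩, D.pairing_lamRat_ne_zero, fun _ _ => rfl, hval,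
      fun P hP hg => hval _ ?_⟩
    · rw [RAM.hasOutput_iff, RAM.holdsAt_append, RAM.holdsAt_ofFn]
      refine ⟨fun k => by simpa using hlam k, ?_⟩
      have hlen : ∀ i : Fin D.N, (List.ofFn fun l : Fin (D.s i + 1) =>
          [τ 1 (RAM.outPos D.n D.binomials i + 2 * (l : ℕ)),
            τ 1 (RAM.outPos D.n D.binomials i + 2 * (l : ℕ) + 1)]).flatten.length =
          2 * (D.s i + 1) := fun i => by
        have := RAM.length_flatten_ofFn (fun l : Fin (D.s i + 1) =>
          [τ 1 (RAM.outPos D.n D.binomials i + 2 * (l : ℕ)),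
            τ 1 (RAM.outPos D.n D.binomials i + 2 * (l : ℕ) + 1)]) (fun l => 2 * l)
          fun l => by simp; ring
        simpa using this
      have h := RAM.holdsAt_flatten_ofFn (f := τ 1) (fun i : Fin D.N =>
        (List.ofFn fun l : Fin (D.s i + 1) =>
          [τ 1 (RAM.outPos D.n D.binomials i + 2 * (l : ℕ)),
            τ 1 (RAM.outPos D.n D.binomials i + 2 * (l : ℕ) + 1)]).flatten)
        (RAM.outPos D.n D.binomials)
        (fun i => by rw [RAM.outPos_succ, hlen, D.binomials_val])
      have h0 : RAM.outPos D.n D.binomials 0 = 0 + (List.ofFn D.lamVal).length := by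
        simp [RAM.outPos]
      rw [← h0, h]
      intro i
      refine (RAM.holdsAt_flatten_ofFn (f := τ 1) _
        (fun l => RAM.outPos D.n D.binomials i + 2 * l) (fun l => by simp; ring)).2 fun l => ?_
      intro k hk
      rcases k with _ | _ | k
      · simp
      · simp
      · simp at hk
    · obtain ⟨R, hR⟩ := hP.exists_abs_le
      rw [← hg]
      exact hasValueAtOne_generatingFunction (finite_latticePoints hR)
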